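/- Let $d\in\mathbb N$, let $\Omega\subset\mathbb R^d$ be compact with boundary of Lebesgue measure zero, let $\Omega_c\subset\Omega$ be measurable, and let $\nu,\alpha,T>0$. Let $B:L^2(\Omega_c)\to L^2(\Omega)$ be the injection (extension by zero) and $B^*$ its adjoint. The Laplace operator is taken with homogeneous boundary conditions encoded by a closed subspace $V$ with $H^1_0(\Omega)\subset V\subset H^1(\Omega)$ (Dirichlet: $V=H^1_0$; Neumann: $V=H^1$; or mixed conditions), Sobolev spaces being taken on the interior of $\Omega$. For $0\le a<b\le T$, solutions of parabolic equations on $[a,b]$ are weak solutions in $C([a,b];L^2(\Omega))\cap L^2(a,b;V)$. Given $y_0,y_{target}\in L^2(\Omega)$, let $v^*\in L^2(0,T;L^2(\Omega_c))$ be a minimizer of $$J(v)=\tfrac12\|y(T)-y_{target}\|_{L^2(\Omega)}^2+\tfrac{\alpha}{2}\|v\|_{L^2(0,T;L^2(\Omega_c))}^2,\qquad \partial_t y-\nu\Delta y=Bv,\quad y(0)=y_0 .$$ Let $y^*$ be the state of $v^*$, let $p^*$ be the solution of the adjoint equation $\partial_t p^*+\nu\Delta p^*=0$ on $[0,T]$,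 $p^*(T)=y^*(T)-y_{target}$, and let $\chi^*=y^*-p^*$ be the target trajectory. Let $N\ge1$, $0=t_0<t_1<\dots<t_N=T$, and $I_n=[t_n,t_{n+1}]$ for $0\le n\le N-1$. For $v_n\in L^2(I_n;L^2(\Omega_c))$ let $y_n$ be the solution of $\partial_t y_n-\nu\Delta y_n=Bv_n$ on $I_n$, $y_n(t_n)=y^*(t_n)$, and put $$J_n(v_n)=\tfrac12\|y_n(t_{n+1})-\chi^*(t_{n+1})\|_{L^2(\Omega)}^2+\tfrac{\alpha}{2}\|v_n\|_{L^2(I_n;L^2(\Omega_c))}^2 .$$ Then for every $n$ the following hold. (i) For every $v_n\in L^2(I_n;L^2(\Omega_c))$ the state $y_n$ exists and is unique, so that $J_n$ is well defined. (ii) The restriction $v^*|_{I_n}$ is the unique minimizer of $J_n$ over $L^2(I_n;L^2(\Omega_c))$. (iii) A control $v_n\in L^2(I_n;L^2(\Omega_c))$ satisfies, together with its state $y_n$ and some $p_n$, the optimality system $$\partial_t p_n+\nu\Delta p_n=0 \text{ on } I_n,\quad p_n(t_{n+1})=y_n(t_{n+1})-\chi^*(t_{n+1}),\qquad \alpha v_n+B^*p_n=0$$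 if and only if $v_n=v^*|_{I_n}$. -/

import Mathlib

open MeasureTheory Set
open scoped ENNReal ContDiff RealInnerProductSpace

noncomputable section

namespace HeatControl

/-- Euclidean space `ℝ^d`. -/
abbrev Space (d : ℕ) : Type := EuclideanSpace ℝ (Fin d)

/-- The Hilbert space `L²(Ω)`. -/
abbrev L2 {d : ℕ} (Ω : Set (Space d)) : Type :=
  Lp ℝ 2 ((volume : Measure (Space d)).restrict Ω)

/-- The Hilbert space `L²(Ω; ℝ^d)` of square integrable vector fields. -/
abbrev L2Vec {d : ℕ} (Ω : Set (Space d)) : Type :=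
  Lp (Space d) 2 ((volume : Measure (Space d)).restrict Ω)

/-- The Hilbert sum `L²(Ω) ⊕ L²(Ω; ℝ^d)`. A Sobolev function `u` is represented by the pair
`(u, ∇u)`; the norm of this pair is the `H¹` norm of `u`. -/
abbrev L2Pair {d : ℕ} (Ω : Set (Space d)) : Type := WithLp 2 (L2 Ω × L2Vec Ω)

/-- Test functions: smooth with compact support inside the interior of `Ω`. -/
structure IsTest {d : ℕ} (Ω : Set (Space d)) (φ : Space d → ℝ) : Prop where
  smooth : ContDiff ℝ ∞ φ
  compact : HasCompactSupport φ
  supp : tsupport φ ⊆ interior Ω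

/-- `G` is the weak gradient of `u` in the interior of `Ω`. -/
def IsWeakGradient {d : ℕ} (Ω : Set (Space d)) (u : L2 Ω) (G : L2Vec Ω) : Prop :=
  ∀ φ : Space d → ℝ, IsTest Ω φ → ∀ e : Space d,
    ∫ x in Ω, u x * fderiv ℝ φ x e = - ∫ x in Ω, ⟪G x, e⟫ * φ x

theorem IsTest.memLp_fderiv {d : ℕ} {Ω : Set (Space d)} {φ : Space d → ℝ} (hφ : IsTest Ω φ)
    (e : Space d) : MemLp (fun x => fderiv ℝ φ x e) 2 (volume.restrict Ω) := by
  have h1 : Continuous (fun x => fderiv ℝ φ x e) :=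
    (hφ.smooth.continuous_fderiv (by simp)).clm_apply continuous_const
  have h2 : HasCompactSupport (fun x => fderiv ℝ φ x e) := hφ.compact.fderiv_apply (𝕜 := ℝ) e
  exact (h1.memLp_of_hasCompactSupport h2).restrict Ω

theorem IsTest.memLp {d : ℕ} {Ω : Set (Space d)} {φ : Space d → ℝ} (hφ : IsTest Ω φ) :
    MemLp φ 2 (volume.restrict Ω) :=
  (hφ.smooth.continuous.memLp_of_hasCompactSupport hφ.compact).restrict Ω

/-- The Sobolev space `H¹(Ω)`, as the space of pairs `(u, ∇u)`. -/
def H1 {d : ℕ} (Ω : Set (Space d)) : Submodule ℝ (L2Pair Ω) where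
  carrier := {Y | IsWeakGradient Ω Y.fst Y.snd}
  zero_mem' := by
    intro φ _ e
    have h1 : ∫ x in Ω, ((0 : L2Pair Ω).fst : Space d → ℝ) x * fderiv ℝ φ x e = 0 := by
      refine integral_eq_zero_of_ae ?_
      filter_upwards [Lp.coeFn_zero ℝ 2 ((volume : Measure (Space d)).restrict Ω)] with x hx
      rw [WithLp.zero_fst, hx, Pi.zero_apply, zero_mul]
    have h2 : ∫ x in Ω, ⟪((0 : L2Pair Ω).snd : Space d → Space d) x, e⟫ * φ x = 0 := by
      refine integral_eq_zero_of_ae ?_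
      filter_upwards [Lp.coeFn_zero (Space d) 2 ((volume : Measure (Space d)).restrict Ω)]
        with x hx
      rw [WithLp.zero_snd, hx, Pi.zero_apply, inner_zero_left, zero_mul, Pi.zero_apply]
    rw [h1, h2, neg_zero]
  add_mem' := by
    intro Y Z hY hZ φ hφ e
    have h1 : ∫ x in Ω, ((Y + Z).fst : Space d → ℝ) x * fderiv ℝ φ x e
        = ∫ x in Ω, Y.fst x * fderiv ℝ φ x e + Z.fst x * fderiv ℝ φ x e := by
      refine integral_congr_ae ?_
      filter_upwards [Lp.coeFn_add Y.fst Z.fst] with x hx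
      rw [WithLp.add_fst, hx, Pi.add_apply, add_mul]
    have h2 : ∫ x in Ω, ⟪((Y + Z).snd : Space d → Space d) x, e⟫ * φ x
        = ∫ x in Ω, ⟪Y.snd x, e⟫ * φ x + ⟪Z.snd x, e⟫ * φ x := by
      refine integral_congr_ae ?_
      filter_upwards [Lp.coeFn_add Y.snd Z.snd] with x hx
      rw [WithLp.add_snd, hx, Pi.add_apply, inner_add_left, add_mul]
    rw [h1, h2, integral_add, integral_add, hY φ hφ e, hZ φ hφ e]
    · ring
    · exact ((Lp.memLp Y.snd).inner_const e).integrable_mul hφ.memLp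
    · exact ((Lp.memLp Z.snd).inner_const e).integrable_mul hφ.memLp
    · exact (Lp.memLp Y.fst).integrable_mul (hφ.memLp_fderiv e)
    · exact (Lp.memLp Z.fst).integrable_mul (hφ.memLp_fderiv e)
  smul_mem' := by
    intro c Y hY φ hφ e
    have h1 : ∫ x in Ω, ((c • Y).fst : Space d → ℝ) x * fderiv ℝ φ x e
        = ∫ x in Ω, c * (Y.fst x * fderiv ℝ φ x e) := by
      refine integral_congr_ae ?_
      filter_upwards [Lp.coeFn_smul c Y.fst] with x hx
      rw [WithLp.smul_fst, hx, Pi.smul_apply, smul_eq_mul, mul_assoc]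
    have h2 : ∫ x in Ω, ⟪((c • Y).snd : Space d → Space d) x, e⟫ * φ x
        = ∫ x in Ω, c * (⟪Y.snd x, e⟫ * φ x) := by
      refine integral_congr_ae ?_
      filter_upwards [Lp.coeFn_smul c Y.snd] with x hx
      rw [WithLp.smul_snd, hx, Pi.smul_apply, real_inner_smul_left, mul_assoc]
    rw [h1, h2, integral_const_mul, integral_const_mul, hY φ hφ e]
    ring

/-- The Sobolev space `H¹₀(Ω)`: the closure in the `H¹` norm of the test functions
(as pairs `(φ, ∇φ)`). -/
def H10 {d : ℕ} (Ω : Set (Space d)) : Submodule ℝ (L2Pair Ω) :=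
  (Submodule.span ℝ {Y : L2Pair Ω | ∃ φ : Space d → ℝ, IsTest Ω φ ∧
    Y.fst =ᵐ[volume.restrict Ω] φ ∧
    Y.snd =ᵐ[volume.restrict Ω] fun x => gradient φ x}).topologicalClosure

/-- A form domain encoding homogeneous boundary conditions for the Laplace operator: a closed
subspace of `H¹(Ω)` containing `H¹₀(Ω)`. The choice `H10 Ω` gives the Dirichlet condition, the
choice `H1 Ω` the Neumann condition, and intermediate choices give mixed conditions. -/
structure IsFormDomain {d : ℕ} (Ω : Set (Space d)) (V : Submodule ℝ (L2Pair Ω)) : Prop where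
  closed : IsClosed (V : Set (L2Pair Ω))
  h10_le : H10 Ω ≤ V
  le_h1 : V ≤ H1 Ω

theorem memLp_indicator {d : ℕ} {Ω Ωc : Set (Space d)} (hΩc : MeasurableSet Ωc) (w : L2 Ωc) :
    MemLp (Ωc.indicator w) 2 (volume.restrict Ω) :=
  ((memLp_indicator_iff_restrict hΩc).2 (Lp.memLp w)).restrict Ω

theorem norm_toLp_indicator_le {d : ℕ} {Ω Ωc : Set (Space d)} (hΩc : MeasurableSet Ωc)
    (w : L2 Ωc) : ‖(memLp_indicator (Ω := Ω) hΩc w).toLp _‖ ≤ ‖w‖ := by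
  rw [Lp.norm_toLp, Lp.norm_def]
  refine ENNReal.toReal_mono (Lp.eLpNorm_ne_top w) ?_
  rw [← eLpNorm_indicator_eq_eLpNorm_restrict hΩc]
  exact eLpNorm_mono_measure _ Measure.restrict_le_self

/-- The injection `B : L²(Ω_c) → L²(Ω)`, extension by zero. -/
def injB {d : ℕ} (Ω : Set (Space d)) {Ωc : Set (Space d)} (hΩc : MeasurableSet Ωc) :
    L2 Ωc →L[ℝ] L2 Ω :=
  LinearMap.mkContinuous
    { toFun := fun w => (memLp_indicator (Ω := Ω) hΩc w).toLp (Ωc.indicator w)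
      map_add' := by
        intro u w
        rw [← MemLp.toLp_add]
        refine MemLp.toLp_congr _ _ (ae_restrict_of_ae ?_)
        filter_upwards [(ae_restrict_iff' hΩc).1 (Lp.coeFn_add u w)] with x hx
        by_cases h : x ∈ Ωc
        · simp only [Pi.add_apply, indicator_of_mem h, hx h]
        · simp [h]
      map_smul' := by
        intro c w
        rw [RingHom.id_apply, ← MemLp.toLp_const_smul]
        refine MemLp.toLp_congr _ _ (ae_restrict_of_ae ?_)
        filter_upwards [(ae_restrict_iff' hΩc).1 (Lp.coeFn_smul c w)] with x hx
        by_cases h : x ∈ Ωc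
        · simp only [Pi.smul_apply, indicator_of_mem h, hx h]
        · simp [h] }
    1 (fun w => by simpa using norm_toLp_indicator_le (Ω := Ω) hΩc w)

/-- The control space `L²([a, b]; L²(Ω_c))`. -/
abbrev Control {d : ℕ} (Ωc : Set (Space d)) (a b : ℝ) : Type :=
  Lp (L2 Ωc) 2 ((volume : Measure ℝ).restrict (Icc a b))

/-- Restriction of a control to a subinterval. -/
def Control.restrict {d : ℕ} {Ωc : Set (Space d)} {a b a' b' : ℝ} (v : Control Ωc a b)
    (h : Icc a' b' ⊆ Icc a b) : Control Ωc a' b' :=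
  ((Lp.memLp v).mono_measure (Measure.restrict_mono h le_rfl)).toLp v

/-- `y` is the weak solution on `[a, b]` of the forward problem `∂ₜ y - ν Δ y = B v`,
`y(a) = ya`, with the boundary conditions given by `V`: `y ∈ C([a, b]; L²(Ω)) ∩ L²(a, b; V)`, and
for every `φ ∈ V` the function `t ↦ (y(t), φ)` is absolutely continuous with
`d/dt (y, φ) + ν (∇y, ∇φ) = (B v, φ)` almost everywhere (written in integrated form). -/
structure IsState {d : ℕ} {Ω Ωc : Set (Space d)} (hΩc : MeasurableSet Ωc)
    (V : Submodule ℝ (L2Pair Ω)) (ν a b : ℝ) (ya : L2 Ω) (v : Control Ωc a b)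
    (y : ℝ → L2 Ω) : Prop where
  cont : ContinuousOn y (Icc a b)
  init : y a = ya
  weak : ∃ Y : ℝ → L2Pair Ω, MemLp Y 2 (volume.restrict (Icc a b)) ∧
    (∀ᵐ s ∂(volume.restrict (Icc a b)), Y s ∈ V ∧ (Y s).fst = y s) ∧
    ∀ φ ∈ V, ∀ t ∈ Icc a b,
      ⟪y t, φ.fst⟫ - ⟪ya, φ.fst⟫ + ν * (∫ s in a..t, ⟪(Y s).snd, φ.snd⟫)
        = ∫ s in a..t, ⟪injB Ω hΩc (v s), φ.fst⟫

/-- `p` is the weak solution on `[a, b]` of the backward problem `∂ₜ p + ν Δ p = 0`,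
`p(b) = pb`, with the boundary conditions given by `V`. -/
structure IsAdjoint {d : ℕ} {Ω : Set (Space d)} (V : Submodule ℝ (L2Pair Ω)) (ν a b : ℝ)
    (pb : L2 Ω) (p : ℝ → L2 Ω) : Prop where
  cont : ContinuousOn p (Icc a b)
  final : p b = pb
  weak : ∃ P : ℝ → L2Pair Ω, MemLp P 2 (volume.restrict (Icc a b)) ∧
    (∀ᵐ s ∂(volume.restrict (Icc a b)), P s ∈ V ∧ (P s).fst = p s) ∧
    ∀ φ ∈ V, ∀ t ∈ Icc a b,
      ⟪pb, φ.fst⟫ - ⟪p t, φ.fst⟫ = ν * (∫ s in t..b, ⟪(P s).snd, φ.snd⟫)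

/-- The cost `½ ‖y(b) - z‖² + (α / 2) ‖v‖²` of a control `v` on `[a, b]` with state `y` and
target `z`. -/
def cost {d : ℕ} {Ω Ωc : Set (Space d)} (α a b : ℝ) (z : L2 Ω) (v : Control Ωc a b)
    (y : ℝ → L2 Ω) : ℝ :=
  1 / 2 * ‖y b - z‖ ^ 2 + α / 2 * ‖v‖ ^ 2

/-- `v` minimizes, over `L²([a, b]; L²(Ω_c))`, the cost with target `z`, where the state starts
from `ya` at time `a`. -/
def IsOptimalControl {d : ℕ} {Ω Ωc : Set (Space d)} (hΩc : MeasurableSet Ωc)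
    (V : Submodule ℝ (L2Pair Ω)) (ν α a b : ℝ) (ya z : L2 Ω) (v : Control Ωc a b) : Prop :=
  ∃ y, IsState hΩc V ν a b ya v y ∧
    ∀ (w : Control Ωc a b) (y' : ℝ → L2 Ω), IsState hΩc V ν a b ya w y' →
      cost α a b z v y ≤ cost α a b z w y'

/-- The optimality system on `[a, b]`: the state equation for `y`, the adjoint equation for `p`
with `p(b) = y(b) - z`, and `α v + B* p = 0`. -/
structure IsOptimalitySystem {d : ℕ} {Ω Ωc : Set (Space d)} (hΩc : MeasurableSet Ωc)
    (V : Submodule ℝ (L2Pair Ω)) (ν α a b : ℝ) (ya z : L2 Ω) (v : Control Ωc a b)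
    (y p : ℝ → L2 Ω) : Prop where
  state : IsState hΩc V ν a b ya v y
  adjoint : IsAdjoint V ν a b (y b - z) p
  gradient : ∀ᵐ s ∂(volume.restrict (Icc a b)),
    α • v s + (ContinuousLinearMap.adjoint (injB Ω hΩc)) (p s) = 0

/-- A subdivision `0 = t₀ < t₁ < ⋯ < t_N = T` of `[0, T]`. -/
structure Subdivision (T : ℝ) (N : ℕ) where
  t : Fin (N + 1) → ℝ
  strictMono : StrictMono t
  t_zero : t 0 = 0
  t_last : t (Fin.last N) = T

theorem Subdivision.Icc_subset {T : ℝ} {N : ℕ} (S : Subdivision T N) (n : Fin N) :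
    Icc (S.t n.castSucc) (S.t n.succ) ⊆ Icc 0 T := by
  refine Icc_subset_Icc ?_ ?_
  · exact S.t_zero.symm.le.trans (S.strictMono.monotone (Fin.zero_le _))
  · exact (S.strictMono.monotone (Fin.le_last _)).trans S.t_last.le

/-- The target trajectory `χ = y - p`. -/
def targetTrajectory {d : ℕ} {Ω : Set (Space d)} (y p : ℝ → L2 Ω) : ℝ → L2 Ω :=
  fun t => y t - p t

end HeatControl

end

/-! Bellman's principle is visible in the optimality system. Since `χ* = y* - p*`, the terminal
condition `p_n(t_{n+1}) = y_n(t_{n+1}) - χ*(t_{n+1})` is met by `p*` itself when `y_n = y*`. The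
state equation, the adjoint equation and the pointwise identity `α v* + B* p* = 0` all restrict to
subintervals, so `(v*, y*, p*)` solves the system on every `I_n`
(`IsOptimalControl.isOptimalitySystem_restrict`). The system is also sufficient for strict
optimality: by `cost_eq_cost_add` the cost of `w` exceeds that of `v` by exactly `½ ‖y_w(b) -
y_v(b)‖² + (α/2) ‖w - v‖² + ⟪w - v, α v + B* p⟫`. When the last factor vanishes, `v` is the only
minimizer, and hence also the only solution of the system.

The expansion rests on the duality `⟪y(b), p(b)⟫ - ⟪y(a), p(a)⟫ = ∫ ⟪f, p⟫`, and the whole argument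
needs well-posedness of the weak parabolic problem. Both are obtained abstractly for a closed `V ⊆ H
× K` (pairs `(u, ∇u)`) whose first components are dense in `H`, through the resolvent `R = (1 -
Δ)⁻¹`. Functions `y = R U` with `U` of class `C¹` are explicit solutions with right-hand side `R U'
+ ν (U - R U)`. They obey an energy estimate, and their data are dense, so their closure supplies a
solution for every datum (`exists_mem_closure_regularSolutions`). Identities are checked on regular
solutions and carried to the closure; uniqueness (`IsWeakSolution.eqOn`) identifies any weak
solution with a member of the closure. -/

noncomputable section

namespace HeatControl

/-! ### The elliptic resolvent, by orthogonal projection. -/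

section Elliptic

variable {H K : Type*} [NormedAddCommGroup H] [InnerProductSpace ℝ H]
  [NormedAddCommGroup K] [InnerProductSpace ℝ K]
  (V : Submodule ℝ (WithLp 2 (H × K))) [V.HasOrthogonalProjection]

/-- The solution operator `h ↦ (u, ∇u)` of the elliptic problem
`(u, φ) + (∇u, ∇φ) = (h, φ)` for all `φ ∈ V`. -/
def ellipticLift : H →L[ℝ] WithLp 2 (H × K) :=
  V.starProjection ∘L ((WithLp.prodContinuousLinearEquiv 2 ℝ H K).symm : H × K →L[ℝ] _) ∘L
    ContinuousLinearMap.inl ℝ H K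

/-- The resolvent `(1 - Δ)⁻¹` on `H`. -/
def ellipticResolvent : H →L[ℝ] H :=
  WithLp.fstL 2 ℝ H K ∘L ellipticLift V

theorem ellipticLift_apply (h : H) :
    ellipticLift V h = V.starProjection (WithLp.toLp 2 (h, (0 : K))) := rfl

@[simp] theorem fst_ellipticLift (h : H) : (ellipticLift V h).fst = ellipticResolvent V h := rfl

theorem ellipticLift_mem (h : H) : ellipticLift V h ∈ V := V.starProjection_apply_mem _

variable {V} in
theorem inner_ellipticLift (h : H) {φ : WithLp 2 (H × K)} (hφ : φ ∈ V) :
    ⟪ellipticLift V h, φ⟫ = ⟪h, φ.fst⟫ := by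
  have := V.starProjection_inner_eq_zero (WithLp.toLp 2 (h, (0 : K))) φ hφ
  rw [inner_sub_left, sub_eq_zero] at this
  rw [ellipticLift_apply, ← this, WithLp.prod_inner_apply]
  simp

variable {V} in
theorem inner_snd_ellipticLift (h : H) {φ : WithLp 2 (H × K)} (hφ : φ ∈ V) :
    ⟪(ellipticLift V h).snd, φ.snd⟫ = ⟪h - ellipticResolvent V h, φ.fst⟫ := by
  have := inner_ellipticLift h hφ
  rw [WithLp.prod_inner_apply] at this
  rw [inner_sub_left, ← this, ← fst_ellipticLift]
  exact (add_sub_cancel_left _ _).symm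

theorem inner_ellipticResolvent_left (h k : H) :
    ⟪ellipticResolvent V h, k⟫ = ⟪h, ellipticResolvent V k⟫ := by
  rw [← fst_ellipticLift, ← fst_ellipticLift, ← inner_ellipticLift h (ellipticLift_mem V k),
    real_inner_comm, ← inner_ellipticLift k (ellipticLift_mem V h), real_inner_comm]

theorem inner_ellipticResolvent_self (h : H) :
    ⟪h, ellipticResolvent V h⟫ = ‖ellipticLift V h‖ ^ 2 := by
  rw [← fst_ellipticLift, ← inner_ellipticLift h (ellipticLift_mem V h), real_inner_self_eq_norm_sq]

theorem inner_ellipticResolvent_sub (h : H) :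
    ⟪ellipticResolvent V h, h - ellipticResolvent V h⟫ = ‖(ellipticLift V h).snd‖ ^ 2 := by
  rw [← real_inner_self_eq_norm_sq, inner_snd_ellipticLift h (ellipticLift_mem V h),
    fst_ellipticLift, real_inner_comm]

/-- With `u = R h`, the pairing equals `‖h - u‖² + ‖∇u‖²`. -/
theorem inner_sub_ellipticResolvent_nonneg (h : H) :
    0 ≤ ⟪h, h - ellipticResolvent V h⟫ := by
  have h1 := inner_ellipticResolvent_sub V h
  have h2 : ⟪h, h - ellipticResolvent V h⟫
      = ‖h - ellipticResolvent V h‖ ^ 2 + ⟪ellipticResolvent V h, h - ellipticResolvent V h⟫ := by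
    rw [← real_inner_self_eq_norm_sq, ← inner_add_left, sub_add_cancel]
  rw [h2, h1]
  positivity

variable {V} in
-- Injectivity of the resolvent is the form in which density of the form domain is used.
theorem eq_zero_of_ellipticLift_eq_zero (hd : ∀ h : H, (∀ φ ∈ V, ⟪h, φ.fst⟫ = 0) → h = 0) {h : H}
    (hh : ellipticLift V h = 0) : h = 0 :=
  hd h fun φ hφ => by rw [← inner_ellipticLift h hφ, hh, inner_zero_left]

end Elliptic

/-! ### Weak solutions and their uniqueness. -/

section Weak

variable {H K : Type*} [NormedAddCommGroup H] [InnerProductSpace ℝ H] [CompleteSpace H]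
  [NormedAddCommGroup K] [InnerProductSpace ℝ K] [CompleteSpace K]
  {V : Submodule ℝ (WithLp 2 (H × K))}

/-- The weak solution of `y' - ν Δ y = f`, `y(a) = ya`, on `[a, b]`. -/
structure IsWeakSolution (V : Submodule ℝ (WithLp 2 (H × K))) (ν a b : ℝ) (ya : H)
    (f : ℝ → H) (y : ℝ → H) : Prop where
  cont : ContinuousOn y (Icc a b)
  init : y a = ya
  weak : ∃ Y : ℝ → WithLp 2 (H × K), MemLp Y 2 (volume.restrict (Icc a b)) ∧
    (∀ᵐ s ∂(volume.restrict (Icc a b)), Y s ∈ V ∧ (Y s).fst = y s) ∧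
    ∀ φ ∈ V, ∀ t ∈ Icc a b,
      ⟪y t, φ.fst⟫ - ⟪ya, φ.fst⟫ + ν * (∫ s in a..t, ⟪(Y s).snd, φ.snd⟫)
        = ∫ s in a..t, ⟪f s, φ.fst⟫

theorem intervalIntegral_eq_setIntegral_restrict {E : Type*} [NormedAddCommGroup E]
    [NormedSpace ℝ E] {a b s t : ℝ} (has : a ≤ s) (hst : s ≤ t) (htb : t ≤ b) (F : ℝ → E) :
    ∫ r in s..t, F r = ∫ r in Ioc s t, F r ∂(volume.restrict (Icc a b)) := by
  rw [intervalIntegral.integral_of_le hst, Measure.restrict_restrict measurableSet_Ioc,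
    inter_eq_left.2 (Ioc_subset_Icc_self.trans (Icc_subset_Icc has htb))]

theorem intervalIntegral_congr_ae_restrict {E : Type*} [NormedAddCommGroup E]
    [NormedSpace ℝ E] {a b s t : ℝ} (has : a ≤ s) (hst : s ≤ t) (htb : t ≤ b) {F G : ℝ → E}
    (h : ∀ᵐ r ∂(volume.restrict (Icc a b)), F r = G r) :
    ∫ r in s..t, F r = ∫ r in s..t, G r := by
  rw [intervalIntegral_eq_setIntegral_restrict has hst htb,
    intervalIntegral_eq_setIntegral_restrict has hst htb]
  exact integral_congr_ae (ae_restrict_of_ae h)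

theorem intervalIntegrable_of_memLp_restrict {E : Type*} [NormedAddCommGroup E]
    {a b s t : ℝ} (has : a ≤ s) (hst : s ≤ t) (htb : t ≤ b) {F : ℝ → E}
    (hF : MemLp F 2 (volume.restrict (Icc a b))) : IntervalIntegrable F volume s t := by
  rw [intervalIntegrable_iff_integrableOn_Ioc_of_le hst]
  have h1 : Integrable F (volume.restrict (Icc a b)) := hF.integrable one_le_two
  exact IntegrableOn.mono_set h1 (Ioc_subset_Icc_self.trans (Icc_subset_Icc has htb))

/-- A primitive of a square integrable function with values in `V` has values in `V`. -/
theorem intervalIntegral_mem_formDomain [V.HasOrthogonalProjection] {a b s t : ℝ} (has : a ≤ s)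
    (hst : s ≤ t) (htb : t ≤ b) {Y : ℝ → WithLp 2 (H × K)}
    (hY : MemLp Y 2 (volume.restrict (Icc a b)))
    (hYV : ∀ᵐ s ∂(volume.restrict (Icc a b)), Y s ∈ V) : ∫ r in s..t, Y r ∈ V := by
  have hi := intervalIntegrable_of_memLp_restrict has hst htb hY
  rw [← Submodule.starProjection_eq_self_iff (K := V),
    ← ContinuousLinearMap.intervalIntegral_comp_comm _ hi]
  refine intervalIntegral_congr_ae_restrict has hst htb ?_
  filter_upwards [hYV] with r hr using Submodule.starProjection_eq_self_iff.2 hr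

theorem intervalIntegral_fst {s t : ℝ} {Y : ℝ → WithLp 2 (H × K)}
    (hi : IntervalIntegrable Y volume s t) :
    (∫ r in s..t, Y r).fst = ∫ r in s..t, (Y r).fst :=
  ((WithLp.fstL 2 ℝ H K).intervalIntegral_comp_comm hi).symm

theorem intervalIntegral_inner_snd {s t : ℝ} {Y : ℝ → WithLp 2 (H × K)}
    (hi : IntervalIntegrable Y volume s t) (k : K) :
    ∫ r in s..t, ⟪(Y r).snd, k⟫ = ⟪(∫ r in s..t, Y r).snd, k⟫ := by
  have := (innerSL ℝ k ∘L WithLp.sndL 2 ℝ H K).intervalIntegral_comp_comm hi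
  rw [real_inner_comm]
  rw [show ⟪k, (∫ r in s..t, Y r).snd⟫ = (innerSL ℝ k ∘L WithLp.sndL 2 ℝ H K)
    (∫ r in s..t, Y r) from rfl, ← this]
  exact intervalIntegral.integral_congr fun r _ => real_inner_comm _ _

/-- The test functions do not depend on time, so the difference `z` of two solutions is tested at
time `t` with its own primitive `W(t) = ∫_a^t z`, which lies in the form domain. This gives `⟪z, W⟫
= -ν ‖∇W‖² ≤ 0`, so `‖W‖²` is nonincreasing from `0`, and `z = W'` vanishes. -/
theorem IsWeakSolution.eqOn [V.HasOrthogonalProjection] {ν a b : ℝ} (hν : 0 < ν) {ya : H}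
    {f y y' : ℝ → H} (h : IsWeakSolution V ν a b ya f y) (h' : IsWeakSolution V ν a b ya f y') :
    EqOn y y' (Icc a b) := by
  obtain ⟨Y, hY, hYV, hw⟩ := h.weak
  obtain ⟨Y', hY', hYV', hw'⟩ := h'.weak
  rcases lt_or_ge b a with hba | hab
  · intro t ht
    exact absurd (ht.1.trans ht.2) (not_le.2 hba)
  have hZ := hY.sub hY'
  have hZV : ∀ᵐ s ∂(volume.restrict (Icc a b)), (Y - Y') s ∈ V := by
    filter_upwards [hYV, hYV'] with s hs hs' using V.sub_mem hs.1 hs'.1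
  have hzc := h.cont.sub h'.cont
  set W : ℝ → H := fun t => ∫ s in a..t, (y s - y' s) with hW
  have key : ∀ t ∈ Icc a b, ⟪y t - y' t, W t⟫ ≤ 0 := by
    intro t ht
    have hi := intervalIntegrable_of_memLp_restrict le_rfl ht.1 ht.2 hZ
    have hi1 := intervalIntegrable_of_memLp_restrict le_rfl ht.1 ht.2 hY
    have hi2 := intervalIntegrable_of_memLp_restrict le_rfl ht.1 ht.2 hY'
    set Q := ∫ s in a..t, (Y - Y') s with hQ
    have hQV : Q ∈ V := intervalIntegral_mem_formDomain le_rfl ht.1 ht.2 hZ hZV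
    have hQf : Q.fst = W t := by
      rw [hQ, intervalIntegral_fst hi]
      refine intervalIntegral_congr_ae_restrict le_rfl ht.1 ht.2 ?_
      filter_upwards [hYV, hYV'] with s hs hs'
      rw [Pi.sub_apply, WithLp.sub_fst, hs.2, hs'.2]
    have hQs : Q.snd = (∫ s in a..t, Y s).snd - (∫ s in a..t, Y' s).snd := by
      rw [← WithLp.sub_snd, ← intervalIntegral.integral_sub hi1 hi2]
      rfl
    have e1 := hw Q hQV t ht
    have e2 := hw' Q hQV t ht
    rw [intervalIntegral_inner_snd hi1] at e1
    rw [intervalIntegral_inner_snd hi2] at e2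
    have e3 : ⟪(∫ s in a..t, Y s).snd, Q.snd⟫ - ⟪(∫ s in a..t, Y' s).snd, Q.snd⟫ = ‖Q.snd‖ ^ 2 := by
      rw [← inner_sub_left, ← hQs, real_inner_self_eq_norm_sq]
    rw [← hQf, inner_sub_left]
    have e4 : 0 ≤ ν * ‖Q.snd‖ ^ 2 := by positivity
    rw [← e3] at e4
    linarith
  have hWd : ∀ t ∈ Ioo a b, HasDerivAt W (y t - y' t) t := by
    intro t ht
    have hnhds : Icc a b ∈ nhds t := Icc_mem_nhds ht.1 ht.2
    refine intervalIntegral.integral_hasDerivAt_right ?_ ?_ (hzc.continuousAt hnhds)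
    · refine ContinuousOn.intervalIntegrable ?_
      rw [uIcc_of_le ht.1.le]
      exact hzc.mono (Icc_subset_Icc_right ht.2.le)
    · exact hzc.stronglyMeasurableAtFilter_nhdsWithin measurableSet_Icc t |>.filter_mono
        (by rw [nhdsWithin_eq_nhds.2 hnhds])
  have hWc : ContinuousOn W (Icc a b) := by
    have := intervalIntegral.continuousOn_primitive_interval (μ := volume)
      (f := fun s => y s - y' s) (a := a) (b := b) ?_
    · rwa [uIcc_of_le hab] at this
    · rw [uIcc_of_le hab]
      exact hzc.integrableOn_Icc
  have hanti : AntitoneOn (fun t => ‖W t‖ ^ 2) (Icc a b) := by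
    refine antitoneOn_of_deriv_nonpos (convex_Icc a b) (hWc.norm.pow 2) ?_ ?_
    · rw [interior_Icc]
      exact fun t ht => (hWd t ht).norm_sq.differentiableAt.differentiableWithinAt
    · rw [interior_Icc]
      intro t ht
      rw [(hWd t ht).norm_sq.deriv, real_inner_comm]
      have := key t (Ioo_subset_Icc_self ht)
      linarith
  have hW0 : ∀ t ∈ Icc a b, W t = 0 := by
    intro t ht
    have h1 := hanti (left_mem_Icc.2 hab) ht ht.1
    have h2 : W a = 0 := intervalIntegral.integral_same
    simp only [h2, norm_zero] at h1
    have h3 : ‖W t‖ ^ 2 = 0 := le_antisymm (by simpa using h1) (sq_nonneg _)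
    simpa using h3
  have hopen : EqOn y y' (Ioo a b) := by
    intro t ht
    have h1 : HasDerivAt W 0 t := by
      refine (hasDerivAt_const t (0 : H)).congr_of_eventuallyEq ?_
      filter_upwards [Icc_mem_nhds ht.1 ht.2] with s hs using hW0 s hs
    exact sub_eq_zero.1 ((hWd t ht).unique h1)
  -- For `a = b` the open interval is empty and only the initial value decides; otherwise continuity
  -- extends the equality to the endpoints.
  rcases hab.eq_or_lt with rfl | hab'
  · intro t ht
    rw [Icc_self, mem_singleton_iff] at ht
    rw [ht, h.init, h'.init]
  · exact hopen.of_subset_closure h.cont h'.cont Ioo_subset_Icc_self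
      (by rw [closure_Ioo hab'.ne])

end Weak

/-! ### Auxiliary facts on square integrable functions of time. -/

section Lp

variable {H : Type*} [NormedAddCommGroup H]

theorem exists_integral_norm_le_mul_norm {α : Type*} [MeasurableSpace α] (μ : Measure α)
    [IsFiniteMeasure μ] : ∃ c : ℝ, 0 ≤ c ∧ ∀ f : Lp H 2 μ, ∫ x, ‖f x‖ ∂μ ≤ c * ‖f‖ := by
  refine ⟨(μ univ ^ (1 / (1 : ℝ≥0∞).toReal - 1 / (2 : ℝ≥0∞).toReal)).toReal,
    ENNReal.toReal_nonneg, fun f => ?_⟩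
  have h1 := eLpNorm_le_eLpNorm_mul_rpow_measure_univ (μ := μ) (p := 1) (q := 2) one_le_two
    (Lp.aestronglyMeasurable f)
  rw [integral_norm_eq_lintegral_enorm (Lp.aestronglyMeasurable f), ← eLpNorm_one_eq_lintegral_enorm,
    Lp.norm_def, mul_comm, ← ENNReal.toReal_mul]
  refine ENNReal.toReal_mono (ENNReal.mul_ne_top (Lp.eLpNorm_ne_top f) ?_) h1
  exact ENNReal.rpow_ne_top_of_nonneg (by norm_num) (measure_ne_top _ _)

theorem memLp_restrict_Icc_of_continuousOn {a b : ℝ} {f : ℝ → H} (hf : ContinuousOn f (Icc a b)) :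
    MemLp f 2 (volume.restrict (Icc a b)) := by
  obtain ⟨C, hC⟩ := isCompact_Icc.exists_bound_of_continuousOn hf
  exact MemLp.of_bound (hf.aestronglyMeasurable_of_isCompact isCompact_Icc measurableSet_Icc) C
    ((ae_restrict_iff' measurableSet_Icc).2 (ae_of_all _ hC))

theorem integral_restrict_Icc {E : Type*} [NormedAddCommGroup E] [NormedSpace ℝ E] {a b : ℝ}
    (hab : a ≤ b) (f : ℝ → E) :
    ∫ x, f x ∂(volume.restrict (Icc a b)) = ∫ x in a..b, f x := by
  rw [intervalIntegral.integral_of_le hab, integral_Icc_eq_integral_Ioc]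

variable [InnerProductSpace ℝ H]

theorem norm_sq_L2_eq_integral {α : Type*} [MeasurableSpace α] {μ : Measure α} (f : Lp H 2 μ) :
    ‖f‖ ^ 2 = ∫ x, ‖f x‖ ^ 2 ∂μ := by
  rw [← real_inner_self_eq_norm_sq, L2.inner_def]
  simp only [real_inner_self_eq_norm_sq]

/-- The pairing of an `L²` function with a constant over a subinterval is an `L²` inner product. -/
theorem intervalIntegral_inner_const {a b t : ℝ} (ht : t ∈ Icc a b)
    (f : Lp H 2 (volume.restrict (Icc a b))) (c : H) :
    ∫ s in a..t, ⟪f s, c⟫ = ⟪indicatorConstLp 2 (measurableSet_Ioc (a := a) (b := t))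
      (measure_ne_top (volume.restrict (Icc a b)) _) c, f⟫ := by
  rw [L2.inner_indicatorConstLp_eq_setIntegral_inner,
    intervalIntegral_eq_setIntegral_restrict le_rfl ht.1 ht.2]
  simp only [real_inner_comm]

end Lp

/-! ### Regular solutions `R U` and their energy estimate. -/

section Regular

variable {H K : Type*} [NormedAddCommGroup H] [InnerProductSpace ℝ H]
  [NormedAddCommGroup K] [InnerProductSpace ℝ K]
  (V : Submodule ℝ (WithLp 2 (H × K))) [V.HasOrthogonalProjection]

/-- The solutions of the form `y = (1 - Δ)⁻¹ U` with `U` continuously differentiable, as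
quadruples `((y(a), f), (y, (y, ∇y)))`, where `f` is the right-hand side of the equation. -/
def regularSolutions (ν : ℝ) {a b : ℝ} (hab : a ≤ b) :
    Submodule ℝ ((H × Lp H 2 ((volume : Measure ℝ).restrict (Icc a b))) ×
      (BoundedContinuousFunction ℝ H ×
        Lp (WithLp 2 (H × K)) 2 ((volume : Measure ℝ).restrict (Icc a b)))) where
  carrier := {x | ∃ U w : ℝ → H, (∀ t, HasDerivAt U (w t) t) ∧ Continuous w ∧
    x.1.1 = ellipticResolvent V (U a) ∧
    x.1.2 =ᵐ[volume.restrict (Icc a b)] (fun t => ellipticResolvent V (w t) +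
      ν • (U t - ellipticResolvent V (U t))) ∧
    -- Freezing the function outside `[a, b]` makes it bounded on `ℝ` and its sup norm the one on
    -- `[a, b]`.
    (∀ t, x.2.1 t = ellipticResolvent V (U (projIcc a b hab t))) ∧
    x.2.2 =ᵐ[volume.restrict (Icc a b)] (fun t => ellipticLift V (U t))}
  zero_mem' := by
    refine ⟨fun _ => 0, fun _ => 0, fun t => hasDerivAt_const _ _, continuous_const, by simp, ?_,
      by simp, ?_⟩
    · filter_upwards [Lp.coeFn_zero H 2 (volume.restrict (Icc a b))] with t ht
      simpa using! ht
    · filter_upwards [Lp.coeFn_zero (WithLp 2 (H × K)) 2 (volume.restrict (Icc a b))] with t ht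
      simpa using! ht
  add_mem' := by
    rintro x x' ⟨U, w, h1, h2, h3, h4, h5, h6⟩ ⟨U', w', h1', h2', h3', h4', h5', h6'⟩
    refine ⟨U + U', w + w', fun t => (h1 t).add (h1' t), h2.add h2', by simp [h3, h3'], ?_,
      by simp [h5, h5'], ?_⟩
    · filter_upwards [Lp.coeFn_add x.1.2 x'.1.2, h4, h4'] with t ht h h'
      rw [Prod.fst_add, Prod.snd_add, ht, Pi.add_apply, h, h']
      simp only [Pi.add_apply, map_add]
      module
    · filter_upwards [Lp.coeFn_add x.2.2 x'.2.2, h6, h6'] with t ht h h'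
      rw [Prod.snd_add, Prod.snd_add, ht, Pi.add_apply, h, h', Pi.add_apply, map_add]
  smul_mem' := by
    rintro c x ⟨U, w, h1, h2, h3, h4, h5, h6⟩
    refine ⟨c • U, c • w, fun t => (h1 t).const_smul c, h2.const_smul c, by simp [h3], ?_,
      by simp [h5], ?_⟩
    · filter_upwards [Lp.coeFn_smul c x.1.2, h4] with t ht h
      rw [Prod.smul_fst, Prod.smul_snd, ht, Pi.smul_apply, h]
      simp only [Pi.smul_apply, map_smul]
      module
    · filter_upwards [Lp.coeFn_smul c x.2.2, h6] with t ht h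
      rw [Prod.smul_snd, Prod.smul_snd, ht, Pi.smul_apply, h, Pi.smul_apply, map_smul]

variable {V}

theorem exists_regularSolution (ν : ℝ) {a b : ℝ} (hab : a ≤ b) {U w : ℝ → H}
    (hU : ∀ t, HasDerivAt U (w t) t) (hw : Continuous w) :
    ∃ x ∈ regularSolutions V ν hab, x.1.1 = ellipticResolvent V (U a) ∧
      x.1.2 =ᵐ[volume.restrict (Icc a b)] (fun t => ellipticResolvent V (w t) +
        ν • (U t - ellipticResolvent V (U t))) := by
  have hUc : Continuous U := continuous_iff_continuousAt.2 fun t => (hU t).continuousAt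
  have hg : Continuous fun t => ellipticResolvent V (w t) +
      ν • (U t - ellipticResolvent V (U t)) := by fun_prop
  have hY : Continuous fun t => ellipticLift V (U t) := by fun_prop
  have hg' := memLp_restrict_Icc_of_continuousOn (a := a) (b := b) hg.continuousOn
  have hY' := memLp_restrict_Icc_of_continuousOn (a := a) (b := b) hY.continuousOn
  let y : C(Icc a b, H) := ⟨fun t => ellipticResolvent V (U t), by fun_prop⟩
  refine ⟨((ellipticResolvent V (U a), hg'.toLp), ((BoundedContinuousFunction.mkOfCompact y).compContinuous
    ⟨projIcc a b hab, continuous_projIcc⟩, hY'.toLp)), ⟨U, w, hU, hw, rfl, hg'.coeFn_toLp,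
      fun t => rfl, hY'.coeFn_toLp⟩, rfl, hg'.coeFn_toLp⟩

/-- Energy identity: the equation is paired with `y = R U` itself, and `⟪R U, U - R U⟫ = ‖∇y‖²`
gives the dissipation. -/
theorem norm_sq_regular_eq (ν : ℝ) {U w : ℝ → H} (hU : ∀ t, HasDerivAt U (w t) t)
    (hw : Continuous w) (a t : ℝ) :
    ‖ellipticResolvent V (U t)‖ ^ 2 + 2 * ν * ∫ s in a..t, ‖(ellipticLift V (U s)).snd‖ ^ 2
      = ‖ellipticResolvent V (U a)‖ ^ 2 + 2 * ∫ s in a..t, ⟪ellipticResolvent V (U s),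
        ellipticResolvent V (w s) + ν • (U s - ellipticResolvent V (U s))⟫ := by
  have hUc : Continuous U := continuous_iff_continuousAt.2 fun t => (hU t).continuousAt
  have c1 : Continuous fun s => ‖(ellipticLift V (U s)).snd‖ ^ 2 :=
    (((WithLp.sndL 2 ℝ H K).continuous.comp ((ellipticLift V).continuous.comp hUc)).norm.pow 2)
  have c2 : Continuous fun s => ⟪ellipticResolvent V (U s),
      ellipticResolvent V (w s) + ν • (U s - ellipticResolvent V (U s))⟫ := by fun_prop
  have hd : ∀ s, HasDerivAt (fun s => ‖ellipticResolvent V (U s)‖ ^ 2)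
      (2 * ⟪ellipticResolvent V (U s),
        ellipticResolvent V (w s) + ν • (U s - ellipticResolvent V (U s))⟫
        - 2 * ν * ‖(ellipticLift V (U s)).snd‖ ^ 2) s := by
    intro s
    have := ((ellipticResolvent V).hasFDerivAt.comp_hasDerivAt s (hU s)).norm_sq
    refine this.congr_deriv ?_
    rw [inner_add_right, real_inner_smul_right, inner_ellipticResolvent_sub]
    simp only [Function.comp_apply]
    ring
  have := intervalIntegral.integral_eq_sub_of_hasDerivAt (a := a) (b := t) (fun s _ => hd s)
    ((by fun_prop : Continuous _).intervalIntegrable _ _)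
  rw [intervalIntegral.integral_sub ((c2.const_mul 2 |>.intervalIntegrable _ _))
    ((c1.const_mul _).intervalIntegrable _ _), intervalIntegral.integral_const_mul,
    intervalIntegral.integral_const_mul] at this
  linarith

variable (V) in
/-- The energy estimate for regular solutions. -/
theorem exists_regularSolutions_bound {ν : ℝ} (hν : 0 < ν) {a b : ℝ} (hab : a ≤ b) :
    ∃ C : ℝ, 0 ≤ C ∧ ∀ x ∈ regularSolutions V ν hab, ‖x.2‖ ≤ C * ‖x.1‖ := by
  obtain ⟨c, hc0, hc⟩ := exists_integral_norm_le_mul_norm (H := H)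
    ((volume : Measure ℝ).restrict (Icc a b))
  have hC2 : 1 ≤ 1 + (b - a) + 1 / (2 * ν) := by
    have : 0 ≤ b - a := sub_nonneg.2 hab
    have : 0 ≤ 1 / (2 * ν) := by positivity
    linarith
  -- The term `b - a` comes from integrating `‖y‖²`, the term `1 / (2 ν)` from the dissipation; the
  -- `1` ensures `C2 ≤ C2 ^ 2`, so that `C2` serves both for the sup norm and after taking a square
  -- root.
  set C2 := 1 + (b - a) + 1 / (2 * ν) with hC2def
  refine ⟨C2 * (1 + 2 * c), by positivity, ?_⟩
  rintro x ⟨U, w, h1, h2, h3, h4, h5, h6⟩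
  have hUc : Continuous U := continuous_iff_continuousAt.2 fun t => (h1 t).continuousAt
  set g : ℝ → H := fun s => ellipticResolvent V (w s) + ν • (U s - ellipticResolvent V (U s)) with hg
  have hgc : Continuous g := by fun_prop
  set y : ℝ → H := fun s => ellipticResolvent V (U s) with hy
  have hyc : Continuous y := by fun_prop
  have hyc2 : Continuous fun s => ‖y s‖ ^ 2 := by fun_prop
  have hsc : Continuous fun s => ‖(ellipticLift V (U s)).snd‖ ^ 2 :=
    (((WithLp.sndL 2 ℝ H K).continuous.comp ((ellipticLift V).continuous.comp hUc)).norm.pow 2)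
  set F := ∫ s in a..b, ‖g s‖ with hF
  have hF0 : 0 ≤ F := intervalIntegral.integral_nonneg hab fun _ _ => norm_nonneg _
  have hFle : F ≤ c * ‖x.1.2‖ := by
    refine le_trans (le_of_eq ?_) (hc x.1.2)
    rw [hF, ← integral_restrict_Icc hab]
    refine integral_congr_ae ?_
    filter_upwards [h4] with s hs
    rw [hs]
  obtain ⟨t₀, ht₀, hmax⟩ := isCompact_Icc.exists_isMaxOn (nonempty_Icc.2 hab)
    (hyc.norm.continuousOn (s := Icc a b))
  set M := ‖y t₀‖ with hM
  have hM0 : 0 ≤ M := norm_nonneg _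
  have hmax' : ∀ t ∈ Icc a b, ‖y t‖ ≤ M := fun t ht => hmax ht
  set m := ‖x.1.1‖ with hm
  have hm0 : 0 ≤ m := norm_nonneg _
  have hen : ∀ t ∈ Icc a b, ‖y t‖ ^ 2 + 2 * ν * ∫ s in a..t, ‖(ellipticLift V (U s)).snd‖ ^ 2
      ≤ m ^ 2 + 2 * (M * F) := by
    intro t ht
    have := norm_sq_regular_eq (V := V) ν h1 h2 a t
    rw [← h3] at this
    have h7 : ∫ s in a..t, ⟪y s, g s⟫ ≤ M * F := by
      calc ∫ s in a..t, ⟪y s, g s⟫ ≤ ∫ s in a..t, M * ‖g s‖ := by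
            refine intervalIntegral.integral_mono_on ht.1
              ((hyc.inner hgc).intervalIntegrable _ _)
              ((hgc.norm.const_mul M).intervalIntegrable _ _) fun s hs => ?_
            exact (real_inner_le_norm _ _).trans
              (mul_le_mul_of_nonneg_right (hmax' s ⟨hs.1, hs.2.trans ht.2⟩) (norm_nonneg _))
        _ ≤ ∫ s in a..b, M * ‖g s‖ := by
            refine intervalIntegral.integral_mono_interval le_rfl ht.1 ht.2
              (ae_of_all _ fun s => by positivity) ((hgc.norm.const_mul M).intervalIntegrable _ _)
        _ = M * F := intervalIntegral.integral_const_mul _ _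
    linarith
  have hint : ∀ t ∈ Icc a b, 0 ≤ 2 * ν * ∫ s in a..t, ‖(ellipticLift V (U s)).snd‖ ^ 2 :=
    fun t ht => mul_nonneg (by positivity)
      (intervalIntegral.integral_nonneg ht.1 fun _ _ => by positivity)
  set N := m + 2 * F with hN
  have hN0 : 0 ≤ N := by positivity
  have hMN : M ≤ N := by
    have e1 := hen t₀ ht₀
    have e2 := hint t₀ ht₀
    -- From `M² ≤ m² + 2 M F`: if `M > m + 2 F`, then `M² > M m + 2 M F ≥ m² + 2 M F`.
    by_contra! hlt
    nlinarith
  have hNle : N ≤ (1 + 2 * c) * ‖x.1‖ := by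
    have e1 : ‖x.1.1‖ ≤ ‖x.1‖ := norm_fst_le _
    have e2 : ‖x.1.2‖ ≤ ‖x.1‖ := norm_snd_le _
    nlinarith
  have hy' : ‖x.2.1‖ ≤ N := by
    refine (BoundedContinuousFunction.norm_le hN0).2 fun t => ?_
    rw [h5]
    exact (hmax' _ (projIcc a b hab t).2).trans hMN
  have hY : ‖x.2.2‖ ^ 2 ≤ C2 * N ^ 2 := by
    have e1 : ‖x.2.2‖ ^ 2 = (∫ s in a..b, ‖y s‖ ^ 2) +
        ∫ s in a..b, ‖(ellipticLift V (U s)).snd‖ ^ 2 := by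
      rw [norm_sq_L2_eq_integral, ← intervalIntegral.integral_add
        (hyc2.intervalIntegrable _ _) (hsc.intervalIntegrable _ _),
        ← integral_restrict_Icc hab]
      refine integral_congr_ae ?_
      filter_upwards [h6] with s hs
      rw [hs, WithLp.prod_norm_sq_eq_of_L2, fst_ellipticLift]
    have e2 : ∫ s in a..b, ‖y s‖ ^ 2 ≤ (b - a) * N ^ 2 := by
      calc ∫ s in a..b, ‖y s‖ ^ 2 ≤ ∫ s in a..b, N ^ 2 := by
            refine intervalIntegral.integral_mono_on hab
              (hyc2.intervalIntegrable _ _) (by simp) fun s hs => ?_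
            exact pow_le_pow_left₀ (norm_nonneg _) ((hmax' s hs).trans hMN) 2
        _ = (b - a) * N ^ 2 := by simp
    have e3 : ∫ s in a..b, ‖(ellipticLift V (U s)).snd‖ ^ 2 ≤ 1 / (2 * ν) * N ^ 2 := by
      have e4 := hen b (right_mem_Icc.2 hab)
      have e5 : 2 * ν * ∫ s in a..b, ‖(ellipticLift V (U s)).snd‖ ^ 2 ≤ N ^ 2 := by
        nlinarith [sq_nonneg ‖y b‖]
      rw [one_div, inv_mul_eq_div, le_div_iff₀ (by positivity)]
      linarith
    rw [e1, hC2def]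
    nlinarith [sq_nonneg N]
  have hY' : ‖x.2.2‖ ≤ C2 * N := by
    refine le_of_sq_le_sq ?_ (by positivity)
    rw [mul_pow]
    refine hY.trans (mul_le_mul_of_nonneg_right ?_ (sq_nonneg _))
    nlinarith
  have : ‖x.2‖ ≤ C2 * N := by
    rw [Prod.norm_def]
    refine max_le (hy'.trans ?_) hY'
    nlinarith
  refine this.trans ?_
  rw [mul_assoc]
  exact mul_le_mul_of_nonneg_left hNle (by positivity)

theorem regularSolutions_isWeakSolution {ν : ℝ} {a b : ℝ} (hab : a ≤ b)
    {x : (H × Lp H 2 ((volume : Measure ℝ).restrict (Icc a b))) ×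
      (BoundedContinuousFunction ℝ H ×
        Lp (WithLp 2 (H × K)) 2 ((volume : Measure ℝ).restrict (Icc a b)))}
    (hx : x ∈ regularSolutions V ν hab) {φ : WithLp 2 (H × K)} (hφ : φ ∈ V) {t : ℝ}
    (ht : t ∈ Icc a b) :
    ⟪x.2.1 t, φ.fst⟫ - ⟪x.1.1, φ.fst⟫ + ν * (∫ s in a..t, ⟪(x.2.2 s).snd, φ.snd⟫)
      = ∫ s in a..t, ⟪x.1.2 s, φ.fst⟫ := by
  obtain ⟨U, w, h1, h2, h3, h4, h5, h6⟩ := hx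
  have hUc : Continuous U := continuous_iff_continuousAt.2 fun t => (h1 t).continuousAt
  have i1 : ∫ s in a..t, ⟪(x.2.2 s).snd, φ.snd⟫
      = ∫ s in a..t, ⟪U s - ellipticResolvent V (U s), φ.fst⟫ := by
    refine intervalIntegral_congr_ae_restrict le_rfl ht.1 ht.2 ?_
    filter_upwards [h6] with s hs
    rw [hs, inner_snd_ellipticLift _ hφ]
  have i2 : ∫ s in a..t, ⟪x.1.2 s, φ.fst⟫ = (∫ s in a..t, ⟪ellipticResolvent V (w s), φ.fst⟫)
      + ν * ∫ s in a..t, ⟪U s - ellipticResolvent V (U s), φ.fst⟫ := by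
    have c1 : Continuous fun s => ⟪ellipticResolvent V (w s), φ.fst⟫ := by fun_prop
    have c2 : Continuous fun s => ν * ⟪U s - ellipticResolvent V (U s), φ.fst⟫ := by fun_prop
    rw [← intervalIntegral.integral_const_mul, ← intervalIntegral.integral_add
      (c1.intervalIntegrable _ _) (c2.intervalIntegrable _ _)]
    refine intervalIntegral_congr_ae_restrict le_rfl ht.1 ht.2 ?_
    filter_upwards [h4] with s hs
    rw [hs, inner_add_left, real_inner_smul_left]
  have i3 : ∫ s in a..t, ⟪ellipticResolvent V (w s), φ.fst⟫
      = ⟪ellipticResolvent V (U t), φ.fst⟫ - ⟪ellipticResolvent V (U a), φ.fst⟫ := by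
    have c1 : Continuous fun s => ⟪ellipticResolvent V (w s), φ.fst⟫ := by fun_prop
    refine intervalIntegral.integral_eq_sub_of_hasDerivAt
      (f := fun s => ⟪ellipticResolvent V (U s), φ.fst⟫) (fun s _ => ?_) (c1.intervalIntegrable _ _)
    have := (((ellipticResolvent V).hasFDerivAt.comp_hasDerivAt s (h1 s))).inner ℝ
      (hasDerivAt_const s φ.fst)
    simpa using! this
  rw [i1, i2, i3, h5, h3, projIcc_of_mem hab ht]

/-- The integrand is the derivative of `½ ⟪U, (1 - R) U⟫`, because `1 - R` is self-adjoint; this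
form is nonnegative and vanishes at `a`. -/
theorem integral_inner_primitive_sub_nonneg {a b : ℝ} {U w : ℝ → H}
    (hU : ∀ t, HasDerivAt U (w t) t) (hw : Continuous w) (hUa : U a = 0) :
    0 ≤ ∫ s in a..b, ⟪w s, U s - ellipticResolvent V (U s)⟫ := by
  have hUc : Continuous U := continuous_iff_continuousAt.2 fun t => (hU t).continuousAt
  have c1 : Continuous fun s => ⟪w s, U s - ellipticResolvent V (U s)⟫ := by fun_prop
  have hd : ∀ s, HasDerivAt (fun s => 1 / 2 * ⟪U s, U s - ellipticResolvent V (U s)⟫)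
      ⟪w s, U s - ellipticResolvent V (U s)⟫ s := by
    intro s
    have e1 : HasDerivAt (fun s => U s - ellipticResolvent V (U s))
        (w s - ellipticResolvent V (w s)) s :=
      (hU s).sub ((ellipticResolvent V).hasFDerivAt.comp_hasDerivAt s (hU s))
    refine (((hU s).inner ℝ e1).const_mul (1 / 2)).congr_deriv ?_
    rw [inner_sub_right, inner_sub_right, ← inner_ellipticResolvent_left, real_inner_comm (w s),
      real_inner_comm (w s)]
    ring
  rw [intervalIntegral.integral_eq_sub_of_hasDerivAt (fun s _ => hd s) (c1.intervalIntegrable _ _),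
    hUa]
  have := inner_sub_ellipticResolvent_nonneg V (U b)
  simp only [inner_zero_left, mul_zero, sub_zero]
  linarith

end Regular

/-! ### Passage to the closure, and duality with the backward problem. -/

section Existence

variable {H K : Type*} [NormedAddCommGroup H] [InnerProductSpace ℝ H]
  [NormedAddCommGroup K] [InnerProductSpace ℝ K]
  {V : Submodule ℝ (WithLp 2 (H × K))} [V.HasOrthogonalProjection]

/-- The weak solution of the backward problem `p' + ν Δ p = 0`, `p(b) = pb`, on `[a, b]`. -/
structure IsWeakAdjoint (V : Submodule ℝ (WithLp 2 (H × K))) (ν a b : ℝ) (pb : H)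
    (p : ℝ → H) : Prop where
  cont : ContinuousOn p (Icc a b)
  final : p b = pb
  weak : ∃ P : ℝ → WithLp 2 (H × K), MemLp P 2 (volume.restrict (Icc a b)) ∧
    (∀ᵐ s ∂(volume.restrict (Icc a b)), P s ∈ V ∧ (P s).fst = p s) ∧
    ∀ φ ∈ V, ∀ t ∈ Icc a b,
      ⟪pb, φ.fst⟫ - ⟪p t, φ.fst⟫ = ν * (∫ s in t..b, ⟪(P s).snd, φ.snd⟫)

/-- Applied to a weak solution of the backward problem, the resolvent gives a solution of an
ordinary differential equation. -/
theorem IsWeakAdjoint.ellipticResolvent_eq [CompleteSpace H] [CompleteSpace K]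
    {ν a b : ℝ} {pb : H} {p : ℝ → H}
    (h : IsWeakAdjoint V ν a b pb p) {t : ℝ} (ht : t ∈ Icc a b) :
    ellipticResolvent V (p t) = ellipticResolvent V pb
      - ν • ∫ s in t..b, (p s - ellipticResolvent V (p s)) := by
  obtain ⟨P, hP, hPV, hw⟩ := h.weak
  have hi := intervalIntegrable_of_memLp_restrict ht.1 ht.2 le_rfl hP
  have hpc : ContinuousOn p (uIcc t b) := by
    rw [uIcc_of_le ht.2]
    exact h.cont.mono (Icc_subset_Icc_left ht.1)
  have hpi : IntervalIntegrable p volume t b := hpc.intervalIntegrable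
  have hpf : (∫ s in t..b, P s).fst = ∫ s in t..b, p s := by
    rw [intervalIntegral_fst hi]
    refine intervalIntegral_congr_ae_restrict ht.1 ht.2 le_rfl ?_
    filter_upwards [hPV] with s hs using hs.2
  have hmem : ∫ s in t..b, P s ∈ V :=
    intervalIntegral_mem_formDomain ht.1 ht.2 le_rfl hP (hPV.mono fun _ hs => hs.1)
  have hint : ∫ s in t..b, (p s - ellipticResolvent V (p s))
      = (∫ s in t..b, p s) - ellipticResolvent V (∫ s in t..b, p s) := by
    rw [intervalIntegral.integral_sub hpi
      (g := fun s => ellipticResolvent V (p s))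
      ((ellipticResolvent V).continuous.comp_continuousOn hpc).intervalIntegrable,
      ContinuousLinearMap.intervalIntegral_comp_comm _ hpi]
  rw [hint]
  refine ext_inner_right ℝ fun k => ?_
  -- Testing with the lift of `k` turns the gradient pairing into one with `k - R k`, and
  -- self-adjointness moves `R` onto `p`.
  have e1 := hw _ (ellipticLift_mem V k) t ht
  rw [intervalIntegral_inner_snd hi, real_inner_comm _ (∫ s in t..b, P s).snd,
    inner_snd_ellipticLift k hmem, hpf, fst_ellipticLift] at e1
  rw [inner_sub_left, real_inner_smul_left, inner_ellipticResolvent_left,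
    inner_ellipticResolvent_left, inner_sub_left, inner_ellipticResolvent_left]
  rw [inner_sub_left, real_inner_comm (∫ s in t..b, p s) k,
    real_inner_comm (∫ s in t..b, p s) (ellipticResolvent V k)] at e1
  linarith

/-- Each clause of the definition is a closed condition in the product norm, so it suffices that
regular solutions satisfy it. -/
theorem isWeakSolution_of_mem_closure {ν : ℝ} {a b : ℝ} (hab : a ≤ b)
    {x : (H × Lp H 2 ((volume : Measure ℝ).restrict (Icc a b))) ×
      (BoundedContinuousFunction ℝ H ×
        Lp (WithLp 2 (H × K)) 2 ((volume : Measure ℝ).restrict (Icc a b)))}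
    (hx : x ∈ (regularSolutions V ν hab).topologicalClosure) :
    IsWeakSolution V ν a b x.1.1 x.1.2 x.2.1 := by
  refine ⟨x.2.1.continuous.continuousOn, ?_, x.2.2, Lp.memLp _, ?_, fun φ hφ t ht => ?_⟩
  · have hcl : IsClosed {x : (H × Lp H 2 ((volume : Measure ℝ).restrict (Icc a b))) ×
      (BoundedContinuousFunction ℝ H ×
        Lp (WithLp 2 (H × K)) 2 ((volume : Measure ℝ).restrict (Icc a b))) |
        BoundedContinuousFunction.evalCLM ℝ a x.2.1 = x.1.1} :=
      isClosed_eq (by fun_prop) (by fun_prop)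
    refine closure_minimal ?_ hcl hx
    rintro x ⟨U, w, h1, h2, h3, h4, h5, h6⟩
    simpa [h3] using! h5 a
  -- The almost everywhere conditions are rewritten as equalities between continuous operators on
  -- `L²` in time, which makes them closed.
  · have hcl : IsClosed {x : (H × Lp H 2 ((volume : Measure ℝ).restrict (Icc a b))) ×
      (BoundedContinuousFunction ℝ H ×
        Lp (WithLp 2 (H × K)) 2 ((volume : Measure ℝ).restrict (Icc a b))) |
        V.starProjection.compLpL 2 _ x.2.2 = x.2.2 ∧
        (WithLp.fstL 2 ℝ H K).compLpL 2 _ x.2.2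
          = BoundedContinuousFunction.toLp 2 _ ℝ x.2.1} :=
      (isClosed_eq (by fun_prop) (by fun_prop)).inter (isClosed_eq (by fun_prop) (by fun_prop))
    have key := closure_minimal (s := (regularSolutions V ν hab : Set _)) ?_ hcl hx
    · filter_upwards [V.starProjection.coeFn_compLpL x.2.2,
        (WithLp.fstL 2 ℝ H K).coeFn_compLpL x.2.2,
        BoundedContinuousFunction.coeFn_toLp (p := 2) (𝕜 := ℝ) _ x.2.1] with s e1 e2 e3
      rw [key.1] at e1
      rw [key.2, e3] at e2
      exact ⟨Submodule.starProjection_eq_self_iff.1 e1.symm, e2.symm⟩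
    · rintro x ⟨U, w, h1, h2, h3, h4, h5, h6⟩
      constructor
      · refine Lp.ext ?_
        filter_upwards [V.starProjection.coeFn_compLpL x.2.2, h6] with s e1 e2
        rw [e1, e2]
        exact Submodule.starProjection_eq_self_iff.2 (ellipticLift_mem V _)
      · refine Lp.ext ?_
        filter_upwards [(WithLp.fstL 2 ℝ H K).coeFn_compLpL x.2.2, h6,
          BoundedContinuousFunction.coeFn_toLp (p := 2) (𝕜 := ℝ) _ x.2.1,
          ae_restrict_mem measurableSet_Icc] with s e1 e2 e3 hs
        rw [e1, e2, e3, h5, projIcc_of_mem hab hs]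
        rfl
  · have e1 : ∀ x : (H × Lp H 2 ((volume : Measure ℝ).restrict (Icc a b))) ×
        (BoundedContinuousFunction ℝ H ×
          Lp (WithLp 2 (H × K)) 2 ((volume : Measure ℝ).restrict (Icc a b))),
        ∫ s in a..t, ⟪(x.2.2 s).snd, φ.snd⟫ = ∫ s in a..t,
          ⟪((WithLp.sndL 2 ℝ H K).compLpL 2 (volume.restrict (Icc a b)) x.2.2) s, φ.snd⟫ := by
      intro x
      refine intervalIntegral_congr_ae_restrict le_rfl ht.1 ht.2 ?_
      filter_upwards [(WithLp.sndL 2 ℝ H K).coeFn_compLpL x.2.2] with s hs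
      rw [hs]
      rfl
    have hcl : IsClosed {x : (H × Lp H 2 ((volume : Measure ℝ).restrict (Icc a b))) ×
      (BoundedContinuousFunction ℝ H ×
        Lp (WithLp 2 (H × K)) 2 ((volume : Measure ℝ).restrict (Icc a b))) |
        ⟪x.2.1 t, φ.fst⟫ - ⟪x.1.1, φ.fst⟫ + ν * (∫ s in a..t, ⟪(x.2.2 s).snd, φ.snd⟫)
          = ∫ s in a..t, ⟪x.1.2 s, φ.fst⟫} := by
      simp only [e1, intervalIntegral_inner_const ht]
      have : Continuous fun x : (H × Lp H 2 ((volume : Measure ℝ).restrict (Icc a b))) ×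
          (BoundedContinuousFunction ℝ H ×
            Lp (WithLp 2 (H × K)) 2 ((volume : Measure ℝ).restrict (Icc a b))) => x.2.1 t :=
        (BoundedContinuousFunction.evalCLM ℝ t).continuous.comp (by fun_prop)
      exact isClosed_eq (by fun_prop) (by fun_prop)
    exact closure_minimal (fun x hx => regularSolutions_isWeakSolution hab hx hφ ht) hcl hx

/-- The duality between the forward and the backward problem. -/
theorem inner_sub_inner_eq_of_mem_closure [CompleteSpace H] [CompleteSpace K]
    {ν : ℝ} {a b : ℝ} (hab : a ≤ b)
    {x : (H × Lp H 2 ((volume : Measure ℝ).restrict (Icc a b))) ×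
      (BoundedContinuousFunction ℝ H ×
        Lp (WithLp 2 (H × K)) 2 ((volume : Measure ℝ).restrict (Icc a b)))}
    (hx : x ∈ (regularSolutions V ν hab).topologicalClosure) {pb : H} {p : ℝ → H}
    (hp : IsWeakAdjoint V ν a b pb p) :
    ⟪x.2.1 b, pb⟫ - ⟪x.1.1, p a⟫
      = ⟪x.1.2, (memLp_restrict_Icc_of_continuousOn hp.cont).toLp p⟫ := by
  have hcl : IsClosed {x : (H × Lp H 2 ((volume : Measure ℝ).restrict (Icc a b))) ×
      (BoundedContinuousFunction ℝ H ×
        Lp (WithLp 2 (H × K)) 2 ((volume : Measure ℝ).restrict (Icc a b))) |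
      ⟪x.2.1 b, pb⟫ - ⟪x.1.1, p a⟫
        = ⟪x.1.2, (memLp_restrict_Icc_of_continuousOn hp.cont).toLp p⟫} := by
    have : Continuous fun x : (H × Lp H 2 ((volume : Measure ℝ).restrict (Icc a b))) ×
        (BoundedContinuousFunction ℝ H ×
          Lp (WithLp 2 (H × K)) 2 ((volume : Measure ℝ).restrict (Icc a b))) => x.2.1 b :=
      (BoundedContinuousFunction.evalCLM ℝ b).continuous.comp (by fun_prop)
    exact isClosed_eq (by fun_prop) (by fun_prop)
  refine closure_minimal ?_ hcl hx
  rintro x ⟨U, w, h1, h2, h3, h4, h5, h6⟩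
  have hUc : Continuous U := continuous_iff_continuousAt.2 fun t => (h1 t).continuousAt
  have hqc : ContinuousOn (fun s => p s - ellipticResolvent V (p s)) (Icc a b) :=
    hp.cont.sub ((ellipticResolvent V).continuous.comp_continuousOn hp.cont)
  have hd : ∀ t ∈ Ioo a b, HasDerivAt (fun s => ellipticResolvent V (p s))
      (ν • (p t - ellipticResolvent V (p t))) t := by
    intro t ht
    have hnhds : Icc a b ∈ nhds t := Icc_mem_nhds ht.1 ht.2
    have e1 : HasDerivAt (fun t => ∫ s in t..b, (p s - ellipticResolvent V (p s)))
        (-(p t - ellipticResolvent V (p t))) t := by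
      refine intervalIntegral.integral_hasDerivAt_left ?_ ?_ (hqc.continuousAt hnhds)
      · refine ContinuousOn.intervalIntegrable ?_
        rw [uIcc_of_le ht.2.le]
        exact hqc.mono (Icc_subset_Icc_left ht.1.le)
      · exact hqc.stronglyMeasurableAtFilter_nhdsWithin measurableSet_Icc t |>.filter_mono
          (by rw [nhdsWithin_eq_nhds.2 hnhds])
    have e2 := (e1.const_smul ν).const_sub (ellipticResolvent V pb)
    rw [smul_neg, neg_neg] at e2
    refine e2.congr_of_eventuallyEq ?_
    filter_upwards [hnhds] with s hs using hp.ellipticResolvent_eq hs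
  have hgc : ContinuousOn (fun s => ⟪ellipticResolvent V (w s) +
      ν • (U s - ellipticResolvent V (U s)), p s⟫) (Icc a b) :=
    ContinuousOn.inner (by fun_prop : Continuous _).continuousOn hp.cont
  -- The product differentiated is `⟪U, R p⟫`, equal to `⟪y, p⟫` by self-adjointness: `p` is only
  -- continuous in `H`, whereas `R p` solves an ordinary differential equation.
  have ftc := intervalIntegral.integral_eq_sub_of_hasDerivAt_of_le hab
    (f := fun s => ⟪U s, ellipticResolvent V (p s)⟫)
    (f' := fun s => ⟪ellipticResolvent V (w s) + ν • (U s - ellipticResolvent V (U s)), p s⟫)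
    (hUc.continuousOn.inner ((ellipticResolvent V).continuous.comp_continuousOn hp.cont)) ?_
    (ContinuousOn.intervalIntegrable (by rwa [uIcc_of_le hab]))
  · rw [hp.final] at ftc
    rw [mem_ofPred_eq, L2.inner_def, h3, h5, projIcc_right]
    rw [inner_ellipticResolvent_left, inner_ellipticResolvent_left]
    refine ftc.symm.trans ?_
    rw [← integral_restrict_Icc hab]
    refine integral_congr_ae ?_
    filter_upwards [h4, (memLp_restrict_Icc_of_continuousOn hp.cont).coeFn_toLp] with s e1 e2
    rw [e1, e2]
  · intro t ht
    refine ((h1 t).inner ℝ (hd t ht)).congr_deriv ?_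
    rw [inner_add_left, real_inner_smul_left, real_inner_smul_right, inner_sub_left,
      inner_sub_right, inner_ellipticResolvent_left, inner_ellipticResolvent_left]
    ring

end Existence

/-! ### Density of the data, hence solvability for all data. -/

section Density

variable {H K : Type*} [NormedAddCommGroup H] [InnerProductSpace ℝ H] [CompleteSpace H]
  [NormedAddCommGroup K] [InnerProductSpace ℝ K]
  {V : Submodule ℝ (WithLp 2 (H × K))} [V.HasOrthogonalProjection]

/-- If `g` is orthogonal to all right-hand sides of regular solutions which vanish at time `a`,
then `g = 0`. -/
theorem eq_zero_of_forall_inner_rhs_eq_zero (hd : ∀ h : H, (∀ φ ∈ V, ⟪h, φ.fst⟫ = 0) → h = 0)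
    {ν : ℝ} (hν : 0 < ν) {a b : ℝ} (hab : a ≤ b)
    (g : Lp H 2 ((volume : Measure ℝ).restrict (Icc a b)))
    (hg : ∀ x ∈ regularSolutions V ν hab, x.1.1 = 0 → ⟪x.1.2, g⟫ = 0) : g = 0 := by
  revert g
  set μ := (volume : Measure ℝ).restrict (Icc a b) with hμ
  intro g hg
  obtain ⟨c, hc0, hc⟩ := exists_integral_norm_le_mul_norm (H := H) μ
  -- A bound for the map from `u` to `R u + ν (U - R U)` with `U = ∫_a u`: the first summand bounds
  -- `R u`, the second the remaining term, which is bounded in sup norm and then in `L²`.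
  set C := ‖(ellipticResolvent V).compLpL 2 μ‖ +
    (measureUnivNNReal μ : ℝ) ^ (2 : ℝ≥0∞).toReal⁻¹ *
      (ν * ((1 + ‖ellipticResolvent V‖) * c)) with hC
  -- For continuous `u`, let `f` be the right-hand side generated by its primitive. Coercivity gives
  -- `‖lift u‖² ≤ ⟪u, f⟫`, and `⟪g, f⟫ = 0` lets `u - g` replace `u`. The resulting inequality no
  -- longer mentions `f` and is closed in `u`, so density allows `u = g`, for which its right side
  -- vanishes.
  have main : ∀ u : Lp H 2 μ, ‖(ellipticLift V).compLpL 2 μ u‖ ^ 2 ≤ ‖u - g‖ * (C * ‖u‖) := by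
    intro u
    refine (BoundedContinuousFunction.toLp_denseRange (p := 2) H μ ℝ (by simp)).induction_on
      (p := fun u => ‖(ellipticLift V).compLpL 2 μ u‖ ^ 2 ≤ ‖u - g‖ * (C * ‖u‖)) u
      (isClosed_le (by fun_prop) (by fun_prop)) fun w => ?_
    set u := BoundedContinuousFunction.toLp 2 μ ℝ w with hu
    have huw : u =ᵐ[μ] w := BoundedContinuousFunction.coeFn_toLp _ _ _ _
    have hwc : Continuous w := w.continuous
    set U : ℝ → H := fun t => ∫ s in a..t, w s with hUdef
    have hU : ∀ t, HasDerivAt U (w t) t := fun t =>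
      intervalIntegral.integral_hasDerivAt_right (hwc.intervalIntegrable _ _)
        (hwc.stronglyMeasurableAtFilter _ _) hwc.continuousAt
    have hUc : Continuous U := continuous_iff_continuousAt.2 fun t => (hU t).continuousAt
    have hUa : U a = 0 := intervalIntegral.integral_same
    obtain ⟨x, hx, hx1, hx2⟩ := exists_regularSolution (V := V) ν hab hU hwc
    have hgx := hg x hx (by rw [hx1, hUa, map_zero])
    set f := x.1.2 with hf
    have hUbound : ∀ t ∈ Icc a b, ‖U t‖ ≤ c * ‖u‖ := by
      intro t ht
      calc ‖U t‖ ≤ ∫ s in a..t, ‖w s‖ := intervalIntegral.norm_integral_le_integral_norm ht.1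
        _ ≤ ∫ s in a..b, ‖w s‖ :=
            intervalIntegral.integral_mono_interval le_rfl ht.1 ht.2
              (ae_of_all _ fun s => norm_nonneg _) (hwc.norm.intervalIntegrable _ _)
        _ = ∫ s, ‖u s‖ ∂μ := by
            rw [← integral_restrict_Icc hab]
            refine integral_congr_ae ?_
            filter_upwards [huw] with s hs
            rw [hs]
        _ ≤ c * ‖u‖ := hc u
    have hRu := (ellipticResolvent V).coeFn_compLpL (p := 2) (μ := μ) u
    have hfle : ‖f‖ ≤ C * ‖u‖ := by
      have e1 : ‖f - (ellipticResolvent V).compLpL 2 μ u‖ ≤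
          (measureUnivNNReal μ : ℝ) ^ (2 : ℝ≥0∞).toReal⁻¹ *
            (ν * ((1 + ‖ellipticResolvent V‖) * (c * ‖u‖))) := by
        refine Lp.norm_le_of_ae_bound (by positivity) ?_
        filter_upwards [Lp.coeFn_sub f ((ellipticResolvent V).compLpL 2 μ u), hx2, huw, hRu,
          ae_restrict_mem measurableSet_Icc] with s k1 k2 k3 k4 hs
        rw [k1, Pi.sub_apply, k2, k4, k3, add_sub_cancel_left, norm_smul, Real.norm_of_nonneg hν.le]
        refine mul_le_mul_of_nonneg_left ?_ hν.le
        calc ‖U s - ellipticResolvent V (U s)‖ ≤ ‖U s‖ + ‖ellipticResolvent V‖ * ‖U s‖ :=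
              (norm_sub_le _ _).trans (add_le_add_right ((ellipticResolvent V).le_opNorm _) _)
          _ = (1 + ‖ellipticResolvent V‖) * ‖U s‖ := by ring
          _ ≤ (1 + ‖ellipticResolvent V‖) * (c * ‖u‖) :=
              mul_le_mul_of_nonneg_left (hUbound s hs) (by positivity)
      have e2 := ((ellipticResolvent V).compLpL 2 μ).le_opNorm u
      calc ‖f‖ = ‖(ellipticResolvent V).compLpL 2 μ u +
            (f - (ellipticResolvent V).compLpL 2 μ u)‖ := by rw [add_sub_cancel]
        _ ≤ _ := norm_add_le _ _
        _ ≤ _ := add_le_add e2 e1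
        _ = C * ‖u‖ := by rw [hC]; ring
    have hlow : ‖(ellipticLift V).compLpL 2 μ u‖ ^ 2 ≤ ⟪u, f⟫ := by
      have c1 : Continuous fun s => ‖ellipticLift V (w s)‖ ^ 2 := by fun_prop
      have c2 : Continuous fun s => ν * ⟪w s, U s - ellipticResolvent V (U s)⟫ := by fun_prop
      have e1 : ‖(ellipticLift V).compLpL 2 μ u‖ ^ 2 = ∫ s in a..b, ‖ellipticLift V (w s)‖ ^ 2 := by
        rw [norm_sq_L2_eq_integral, ← integral_restrict_Icc hab]
        refine integral_congr_ae ?_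
        filter_upwards [(ellipticLift V).coeFn_compLpL (p := 2) (μ := μ) u, huw] with s k1 k2
        rw [k1, k2]
      have e2 : ⟪u, f⟫ = (∫ s in a..b, ‖ellipticLift V (w s)‖ ^ 2) +
          ν * ∫ s in a..b, ⟪w s, U s - ellipticResolvent V (U s)⟫ := by
        rw [← intervalIntegral.integral_const_mul, ← intervalIntegral.integral_add
          (c1.intervalIntegrable _ _) (c2.intervalIntegrable _ _), L2.inner_def,
          ← integral_restrict_Icc hab]
        refine integral_congr_ae ?_
        filter_upwards [hx2, huw] with s k1 k2
        rw [k1, k2, inner_add_right, real_inner_smul_right, inner_ellipticResolvent_self]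
      rw [e1, e2, le_add_iff_nonneg_right]
      exact mul_nonneg hν.le (integral_inner_primitive_sub_nonneg hU hwc hUa)
    calc ‖(ellipticLift V).compLpL 2 μ u‖ ^ 2 ≤ ⟪u, f⟫ := hlow
      _ = ⟪u - g, f⟫ := by rw [inner_sub_left, real_inner_comm f g, hgx, sub_zero]
      _ ≤ ‖u - g‖ * ‖f‖ := real_inner_le_norm _ _
      _ ≤ ‖u - g‖ * (C * ‖u‖) := mul_le_mul_of_nonneg_left hfle (norm_nonneg _)
  have h0 : (ellipticLift V).compLpL 2 μ g = 0 := by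
    have := main g
    rw [sub_self, norm_zero, zero_mul] at this
    have := le_antisymm this (sq_nonneg _)
    simpa using this
  refine Lp.ext ?_
  filter_upwards [(ellipticLift V).coeFn_compLpL (p := 2) (μ := μ) g, Lp.coeFn_zero H 2 μ,
    Lp.coeFn_zero (WithLp 2 (H × K)) 2 μ] with s k1 k2 k3
  rw [h0, k3] at k1
  rw [k2]
  exact eq_zero_of_ellipticLift_eq_zero hd k1.symm

/-- The data of regular solutions are dense. -/
theorem topologicalClosure_map_fst_regularSolutions
    (hd : ∀ h : H, (∀ φ ∈ V, ⟪h, φ.fst⟫ = 0) → h = 0)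
    {ν : ℝ} (hν : 0 < ν) {a b : ℝ} (hab : a ≤ b) :
    ((regularSolutions V ν hab).map (LinearMap.fst ℝ _ _)).topologicalClosure = ⊤ := by
  set μ := (volume : Measure ℝ).restrict (Icc a b) with hμ
  set N := ((regularSolutions V ν hab).map (LinearMap.fst ℝ _ _)).topologicalClosure with hN
  have hNcl : IsClosed (N : Set (H × Lp H 2 μ)) := Submodule.isClosed_topologicalClosure _
  have hmem : ∀ x ∈ regularSolutions V ν hab, x.1 ∈ N := fun x hx =>
    Submodule.le_topologicalClosure _ ⟨x, hx, rfl⟩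
  have h0 : ∀ f : Lp H 2 μ, ((0 : H), f) ∈ N := by
    let N0 := N.comap (LinearMap.inr ℝ H (Lp H 2 μ))
    have hcl : IsClosed (N0 : Set (Lp H 2 μ)) :=
      hNcl.preimage (by fun_prop : Continuous fun f : Lp H 2 μ => ((0 : H), f))
    have htop : N0 = ⊤ := by
      rw [← hcl.submodule_topologicalClosure_eq, Submodule.topologicalClosure_eq_top_iff,
        Submodule.eq_bot_iff]
      intro g hg
      refine eq_zero_of_forall_inner_rhs_eq_zero hd hν hab g fun x hx hx0 => ?_
      refine (Submodule.mem_orthogonal _ _).1 hg _ ?_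
      change ((0 : H), x.1.2) ∈ N
      rw [← hx0]
      exact hmem x hx
    intro f
    have : f ∈ N0 := htop ▸ Submodule.mem_top
    exact this
  have h1 : ∀ k : H, (k, (0 : Lp H 2 μ)) ∈ N := by
    let N1 := N.comap (LinearMap.inl ℝ H (Lp H 2 μ))
    have hcl : IsClosed (N1 : Set H) :=
      hNcl.preimage (by fun_prop : Continuous fun k : H => (k, (0 : Lp H 2 μ)))
    have htop : N1 = ⊤ := by
      rw [← hcl.submodule_topologicalClosure_eq, Submodule.topologicalClosure_eq_top_iff,
        Submodule.eq_bot_iff]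
      intro h hh
      -- A constant `U = k` has initial value `R k`; its right-hand side is removed with `h0`. Thus
      -- `h` is orthogonal to the range of `R`, and self-adjointness gives `R h = 0`.
      have e1 : ellipticResolvent V h = 0 := by
        refine ext_inner_left ℝ fun k => ?_
        rw [inner_zero_right, ← inner_ellipticResolvent_left]
        refine (Submodule.mem_orthogonal _ _).1 hh _ ?_
        obtain ⟨x, hx, hx1, -⟩ := exists_regularSolution (V := V) ν hab
          (fun t => hasDerivAt_const t k) continuous_const
        have := N.sub_mem (hmem x hx) (h0 x.1.2)
        change (ellipticResolvent V k, (0 : Lp H 2 μ)) ∈ N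
        convert this using 1
        ext1 <;> simp [hx1]
      refine eq_zero_of_ellipticLift_eq_zero hd ?_
      have e2 := inner_ellipticResolvent_self V h
      rw [e1, inner_zero_right] at e2
      simpa using e2.symm
    intro f
    have : f ∈ N1 := htop ▸ Submodule.mem_top
    exact this
  rw [eq_top_iff]
  rintro ⟨k, f⟩ -
  simpa using N.add_mem (h1 k) (h0 f)

/-- Existence of weak solutions, together with the energy estimate. -/
theorem exists_mem_closure_regularSolutions [CompleteSpace K]
    (hd : ∀ h : H, (∀ φ ∈ V, ⟪h, φ.fst⟫ = 0) → h = 0)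
    {ν : ℝ} (hν : 0 < ν) {a b : ℝ} (hab : a ≤ b) :
    ∃ C : ℝ, 0 ≤ C ∧ (∀ x ∈ (regularSolutions V ν hab).topologicalClosure, ‖x.2‖ ≤ C * ‖x.1‖) ∧
      ∀ z, ∃ x ∈ (regularSolutions V ν hab).topologicalClosure, x.1 = z := by
  obtain ⟨C, hC0, hC⟩ := exists_regularSolutions_bound V hν hab
  have hbound : ∀ x ∈ (regularSolutions V ν hab).topologicalClosure, ‖x.2‖ ≤ C * ‖x.1‖ := by
    intro x hx
    have hcl : IsClosed {x : (H × Lp H 2 ((volume : Measure ℝ).restrict (Icc a b))) ×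
        (BoundedContinuousFunction ℝ H ×
          Lp (WithLp 2 (H × K)) 2 ((volume : Measure ℝ).restrict (Icc a b))) |
        ‖x.2‖ ≤ C * ‖x.1‖} := isClosed_le (by fun_prop) (by fun_prop)
    exact closure_minimal hC hcl hx
  refine ⟨C, hC0, hbound, ?_⟩
  set G := (regularSolutions V ν hab).topologicalClosure with hG
  have : CompleteSpace G := (Submodule.isClosed_topologicalClosure _).completeSpace_coe
  let F : G →L[ℝ] (H × Lp H 2 ((volume : Measure ℝ).restrict (Icc a b))) :=
    (ContinuousLinearMap.fst ℝ _ _) ∘L G.subtypeL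
  -- The energy estimate bounds the map from solution to data from below, so on the complete space
  -- `G` its range is closed; density makes it everything.
  have hbij := (ContinuousLinearMap.bijective_iff_dense_range_and_antilipschitz F).2 ⟨?_, ?_⟩
  · intro z
    obtain ⟨x, hx⟩ := hbij.2 z
    exact ⟨x, x.2, hx⟩
  · rw [eq_top_iff, ← topologicalClosure_map_fst_regularSolutions hd hν hab]
    refine Submodule.topologicalClosure_mono ?_
    rintro _ ⟨x, hx, rfl⟩
    exact ⟨⟨x, Submodule.le_topologicalClosure _ hx⟩, rfl⟩
  · refine ⟨⟨max 1 C, by positivity⟩, F.antilipschitz_of_bound fun x => ?_⟩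
    change ‖x.1‖ ≤ max 1 C * ‖x.1.1‖
    rw [Prod.norm_def]
    refine max_le ?_ ((hbound x x.2).trans ?_)
    · exact le_mul_of_one_le_left (norm_nonneg _) (le_max_left _ _)
    · exact mul_le_mul_of_nonneg_right (le_max_right _ _) (norm_nonneg _)

end Density

/-! ### Restriction of weak solutions to subintervals. -/

section WeakRestrict

variable {H K : Type*} [NormedAddCommGroup H] [InnerProductSpace ℝ H]
  [NormedAddCommGroup K] [InnerProductSpace ℝ K]
  {V : Submodule ℝ (WithLp 2 (H × K))}

theorem IsWeakSolution.congr_rhs {ν a b : ℝ} {ya : H} {f f' y : ℝ → H}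
    (h : IsWeakSolution V ν a b ya f y) (hf : f =ᵐ[volume.restrict (Icc a b)] f') :
    IsWeakSolution V ν a b ya f' y := by
  obtain ⟨Y, hY, hYV, hw⟩ := h.weak
  refine ⟨h.cont, h.init, Y, hY, hYV, fun φ hφ t ht => (hw φ hφ t ht).trans ?_⟩
  refine intervalIntegral_congr_ae_restrict le_rfl ht.1 ht.2 ?_
  filter_upwards [hf] with s hs
  rw [hs]

theorem memLp_inner_snd {a b : ℝ} {Y : ℝ → WithLp 2 (H × K)}
    (hY : MemLp Y 2 (volume.restrict (Icc a b))) (k : K) :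
    MemLp (fun s => ⟪(Y s).snd, k⟫) 2 (volume.restrict (Icc a b)) :=
  ((WithLp.sndL 2 ℝ H K).comp_memLp' hY).inner_const k

theorem IsWeakSolution.restrict {ν a b a' b' : ℝ} {ya : H} {f y : ℝ → H}
    (h : IsWeakSolution V ν a b ya f y) (hf : MemLp f 2 (volume.restrict (Icc a b)))
    (ha : a ≤ a') (hab : a' ≤ b') (hb : b' ≤ b) :
    IsWeakSolution V ν a' b' (y a') f y := by
  obtain ⟨Y, hY, hYV, hw⟩ := h.weak
  have hsub : Icc a' b' ⊆ Icc a b := Icc_subset_Icc ha hb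
  refine ⟨h.cont.mono hsub, rfl, Y, hY.mono_measure (Measure.restrict_mono hsub le_rfl),
    ae_restrict_of_ae_restrict_of_subset hsub hYV, fun φ hφ t ht => ?_⟩
  have htb : t ≤ b := ht.2.trans hb
  have e1 := hw φ hφ t (hsub ht)
  have e2 := hw φ hφ a' ⟨ha, hab.trans hb⟩
  rw [← intervalIntegral.integral_add_adjacent_intervals
    (intervalIntegrable_of_memLp_restrict le_rfl ha (ht.1.trans htb) (memLp_inner_snd hY φ.snd))
    (intervalIntegrable_of_memLp_restrict ha ht.1 htb (memLp_inner_snd hY φ.snd)),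
    ← intervalIntegral.integral_add_adjacent_intervals
    (intervalIntegrable_of_memLp_restrict le_rfl ha (ht.1.trans htb) (hf.inner_const φ.fst))
    (intervalIntegrable_of_memLp_restrict ha ht.1 htb (hf.inner_const φ.fst))] at e1
  linarith

theorem IsWeakAdjoint.restrict {ν a b a' b' : ℝ} {pb : H} {p : ℝ → H}
    (h : IsWeakAdjoint V ν a b pb p) (ha : a ≤ a') (hab : a' ≤ b') (hb : b' ≤ b) :
    IsWeakAdjoint V ν a' b' (p b') p := by
  obtain ⟨P, hP, hPV, hw⟩ := h.weak
  have hsub : Icc a' b' ⊆ Icc a b := Icc_subset_Icc ha hb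
  refine ⟨h.cont.mono hsub, rfl, P, hP.mono_measure (Measure.restrict_mono hsub le_rfl),
    ae_restrict_of_ae_restrict_of_subset hsub hPV, fun φ hφ t ht => ?_⟩
  have e1 := hw φ hφ t (hsub ht)
  have e2 := hw φ hφ b' ⟨ha.trans hab, hb⟩
  rw [← intervalIntegral.integral_add_adjacent_intervals
    (intervalIntegrable_of_memLp_restrict (ha.trans ht.1) ht.2 hb (memLp_inner_snd hP φ.snd))
    (intervalIntegrable_of_memLp_restrict (ha.trans hab) hb le_rfl
      (memLp_inner_snd hP φ.snd))] at e1
  linarith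

end WeakRestrict

/-! ### The control problem: cost expansion and optimality system. -/

section Control

variable {d : ℕ} {Ω Ωc : Set (Space d)} {V : Submodule ℝ (L2Pair Ω)}

theorem IsTest.memLp_gradient {φ : Space d → ℝ} (hφ : IsTest Ω φ) :
    MemLp (fun x => gradient φ x) 2 (volume.restrict Ω) := by
  have h1 : Continuous fun x => gradient φ x :=
    (InnerProductSpace.toDual ℝ (Space d)).symm.continuous.comp
      (hφ.smooth.continuous_fderiv (by simp))
  have h2 : HasCompactSupport fun x => gradient φ x :=
    (hφ.compact.fderiv (𝕜 := ℝ)).comp_left (map_zero _)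
  exact (h1.memLp_of_hasCompactSupport h2).restrict Ω

/-- The form domain is dense in `L²(Ω)`. -/
theorem IsFormDomain.eq_zero_of_forall_inner_fst (hV : IsFormDomain Ω V) (hΩ : IsCompact Ω)
    (hΩ' : volume (frontier Ω) = 0) (h : L2 Ω) (hh : ∀ φ ∈ V, ⟪h, φ.fst⟫ = 0) : h = 0 := by
  have : IsFiniteMeasure ((volume : Measure (Space d)).restrict Ω) :=
    ⟨by simpa using hΩ.measure_lt_top⟩
  have hint : Integrable h (volume.restrict Ω) := (Lp.memLp h).integrable one_le_two
  -- Test functions belong to the form domain, so the fundamental lemma of the calculus of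
  -- variations applies, but only in the interior; the rest of `Ω` lies in its null boundary.
  have h1 : ∀ᵐ x ∂(volume.restrict Ω), x ∈ interior Ω → h x = 0 := by
    refine isOpen_interior.ae_eq_zero_of_integral_contDiff_smul_eq_zero
      (hint.locallyIntegrable.locallyIntegrableOn _) fun φ h1 h2 h3 => ?_
    have hφ : IsTest Ω φ := ⟨h1, h2, h3⟩
    have hmem : WithLp.toLp 2 (hφ.memLp.toLp φ, hφ.memLp_gradient.toLp _) ∈ V :=
      hV.h10_le (subset_closure (Submodule.subset_span
        ⟨φ, hφ, hφ.memLp.coeFn_toLp, hφ.memLp_gradient.coeFn_toLp⟩))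
    have e1 := hh _ hmem
    rw [L2.inner_def] at e1
    refine Eq.trans (integral_congr_ae ?_) e1
    filter_upwards [hφ.memLp.coeFn_toLp] with x hx
    rw [show ((WithLp.toLp 2 (hφ.memLp.toLp φ, hφ.memLp_gradient.toLp _) : L2Pair Ω).fst)
      = hφ.memLp.toLp φ from rfl, hx]
    simp
  have h2 : ∀ᵐ x ∂(volume.restrict Ω), x ∉ frontier Ω :=
    ae_restrict_of_ae (measure_eq_zero_iff_ae_notMem.1 hΩ')
  refine Lp.ext ?_
  filter_upwards [h1, h2, ae_restrict_mem hΩ.measurableSet,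
    Lp.coeFn_zero ℝ 2 ((volume : Measure (Space d)).restrict Ω)] with x e1 e2 e3 e4
  rw [e4, Pi.zero_apply]
  refine e1 ?_
  by_contra hx
  exact e2 (hΩ.isClosed.frontier_eq ▸ ⟨e3, hx⟩)

variable {hΩc : MeasurableSet Ωc} {ν α a b : ℝ} {ya z : L2 Ω} {v : Control Ωc a b}
  {y p : ℝ → L2 Ω}

theorem isState_iff_isWeakSolution :
    IsState hΩc V ν a b ya v y ↔
      IsWeakSolution V ν a b ya ((injB Ω hΩc).compLpL 2 (volume.restrict (Icc a b)) v) y := by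
  have hae := (injB Ω hΩc).coeFn_compLpL (p := 2) (μ := volume.restrict (Icc a b)) v
  constructor
  · intro h
    exact IsWeakSolution.congr_rhs (f := fun s => injB Ω hΩc (v s)) ⟨h.cont, h.init, h.weak⟩
      hae.symm
  · intro h
    have := h.congr_rhs (f' := fun s => injB Ω hΩc (v s)) hae
    exact ⟨this.cont, this.init, this.weak⟩

theorem IsAdjoint.isWeakAdjoint {pb : L2 Ω} (h : IsAdjoint V ν a b pb p) :
    IsWeakAdjoint V ν a b pb p := ⟨h.cont, h.final, h.weak⟩

theorem IsAdjoint.restrict {a' b' : ℝ} {pb : L2 Ω} (h : IsAdjoint V ν a b pb p) (ha : a ≤ a')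
    (hab : a' ≤ b') (hb : b' ≤ b) : IsAdjoint V ν a' b' (p b') p :=
  have := h.isWeakAdjoint.restrict ha hab hb
  ⟨this.cont, this.final, this.weak⟩

theorem IsState.restrict {a' b' : ℝ} (h : IsState hΩc V ν a b ya v y) (hab : a' ≤ b')
    (hsub : Icc a' b' ⊆ Icc a b) :
    IsState hΩc V ν a' b' (y a') (v.restrict hsub) y := by
  obtain ⟨ha, hb⟩ := (Icc_subset_Icc_iff hab).1 hsub
  rw [isState_iff_isWeakSolution] at h ⊢
  refine (h.restrict (Lp.memLp _) ha hab hb).congr_rhs ?_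
  filter_upwards [ae_restrict_of_ae_restrict_of_subset hsub
      ((injB Ω hΩc).coeFn_compLpL (p := 2) (μ := volume.restrict (Icc a b)) v),
    (injB Ω hΩc).coeFn_compLpL (p := 2) (μ := volume.restrict (Icc a' b')) (v.restrict hsub),
    ((Lp.memLp v).mono_measure (Measure.restrict_mono hsub le_rfl)).coeFn_toLp] with s e1 e2 e3
  rw [e1, e2]
  exact congrArg _ e3.symm

theorem IsState.eqOn [V.HasOrthogonalProjection] (hν : 0 < ν) {y' : ℝ → L2 Ω}
    (h : IsState hΩc V ν a b ya v y) (h' : IsState hΩc V ν a b ya v y') :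
    EqOn y y' (Icc a b) :=
  (isState_iff_isWeakSolution.1 h).eqOn hν (isState_iff_isWeakSolution.1 h')

theorem exists_isState [V.HasOrthogonalProjection]
    (hd : ∀ h : L2 Ω, (∀ φ ∈ V, ⟪h, φ.fst⟫ = 0) → h = 0)
    (hν : 0 < ν) (hab : a ≤ b) (ya : L2 Ω)
    (v : Control Ωc a b) : ∃ y, IsState hΩc V ν a b ya v y := by
  obtain ⟨C, -, -, hex⟩ := exists_mem_closure_regularSolutions hd hν hab
  obtain ⟨x, hx, hxz⟩ := hex (ya, (injB Ω hΩc).compLpL 2 _ v)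
  refine ⟨x.2.1, isState_iff_isWeakSolution.2 ?_⟩
  simpa only [hxz] using isWeakSolution_of_mem_closure hab hx

/-- The difference of two states with the same initial value is a limit of regular solutions. -/
theorem IsState.exists_sub_mem_closure [V.HasOrthogonalProjection]
    (hd : ∀ h : L2 Ω, (∀ φ ∈ V, ⟪h, φ.fst⟫ = 0) → h = 0)
    (hν : 0 < ν) (hab : a ≤ b)
    {w : Control Ωc a b} {y' : ℝ → L2 Ω}
    (h : IsState hΩc V ν a b ya v y) (h' : IsState hΩc V ν a b ya w y') :
    ∃ x ∈ (regularSolutions V ν hab).topologicalClosure,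
      x.1 = (0, (injB Ω hΩc).compLpL 2 _ (w - v)) ∧ x.2.1 b = y' b - y b := by
  obtain ⟨C, -, -, hex⟩ := exists_mem_closure_regularSolutions hd hν hab
  have key : ∀ {v : Control Ωc a b} {y : ℝ → L2 Ω}, IsState hΩc V ν a b ya v y →
      ∃ x ∈ (regularSolutions V ν hab).topologicalClosure,
        x.1 = (ya, (injB Ω hΩc).compLpL 2 _ v) ∧ x.2.1 b = y b := by
    intro v y h
    obtain ⟨x, hx, hxz⟩ := hex (ya, (injB Ω hΩc).compLpL 2 _ v)
    refine ⟨x, hx, hxz, ?_⟩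
    have e1 := isWeakSolution_of_mem_closure hab hx
    rw [hxz] at e1
    exact e1.eqOn hν (isState_iff_isWeakSolution.1 h) (right_mem_Icc.2 hab)
  obtain ⟨x, hx, hx1, hx2⟩ := key h
  obtain ⟨x', hx', hx1', hx2'⟩ := key h'
  refine ⟨x' - x, Submodule.sub_mem _ hx' hx, ?_, ?_⟩
  · rw [Prod.fst_sub, hx1, hx1', Prod.mk_sub_mk, sub_self, map_sub]
  · rw [← hx2, ← hx2']
    rfl

/-- The Lipschitz constant of the map from control to final state fixes the step length in the first
order condition. -/
theorem exists_norm_state_sub_le [V.HasOrthogonalProjection]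
    (hd : ∀ h : L2 Ω, (∀ φ ∈ V, ⟪h, φ.fst⟫ = 0) → h = 0)
    (hν : 0 < ν) (hab : a ≤ b)
    (ya : L2 Ω) : ∃ C : ℝ, 0 ≤ C ∧ ∀ (v w : Control Ωc a b) (y y' : ℝ → L2 Ω),
      IsState hΩc V ν a b ya v y → IsState hΩc V ν a b ya w y' →
        ‖y' b - y b‖ ≤ C * ‖w - v‖ := by
  obtain ⟨C, hC0, hC, -⟩ := exists_mem_closure_regularSolutions hd hν hab
  refine ⟨C * ‖(injB Ω hΩc).compLpL 2 (volume.restrict (Icc a b))‖, by positivity,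
    fun v w y y' h h' => ?_⟩
  obtain ⟨x, hx, hx1, hx2⟩ := h.exists_sub_mem_closure hd hν hab h'
  rw [← hx2]
  calc ‖x.2.1 b‖ ≤ ‖x.2.1‖ := x.2.1.norm_coe_le_norm b
    _ ≤ ‖x.2‖ := norm_fst_le _
    _ ≤ C * ‖x.1‖ := hC x hx
    _ = C * ‖(injB Ω hΩc).compLpL 2 (volume.restrict (Icc a b)) (w - v)‖ := by
        rw [hx1, Prod.norm_def, norm_zero, max_eq_right (norm_nonneg _)]
    _ ≤ C * (‖(injB Ω hΩc).compLpL 2 (volume.restrict (Icc a b))‖ * ‖w - v‖) :=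
        mul_le_mul_of_nonneg_left (ContinuousLinearMap.le_opNorm _ _) hC0
    _ = _ := (mul_assoc _ _ _).symm

/-- The exact second order expansion of the cost around a control. -/
theorem cost_eq_cost_add [V.HasOrthogonalProjection]
    (hd : ∀ h : L2 Ω, (∀ φ ∈ V, ⟪h, φ.fst⟫ = 0) → h = 0)
    (hν : 0 < ν) (hab : a ≤ b)
    {w : Control Ωc a b} {y' : ℝ → L2 Ω}
    (h : IsState hΩc V ν a b ya v y) (h' : IsState hΩc V ν a b ya w y')
    (hp : IsAdjoint V ν a b (y b - z) p) :
    cost α a b z w y' = cost α a b z v y + 1 / 2 * ‖y' b - y b‖ ^ 2 + α / 2 * ‖w - v‖ ^ 2 +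
      ⟪w - v, α • v + (ContinuousLinearMap.adjoint (injB Ω hΩc)).compLpL 2 _
        ((memLp_restrict_Icc_of_continuousOn hp.cont).toLp p)⟫ := by
  obtain ⟨x, hx, hx1, hx2⟩ := h.exists_sub_mem_closure hd hν hab h'
  have e1 := inner_sub_inner_eq_of_mem_closure hab hx hp.isWeakAdjoint
  rw [hx2, hx1] at e1
  simp only [inner_zero_left, sub_zero] at e1
  set q := (memLp_restrict_Icc_of_continuousOn hp.cont).toLp p with hq
  have e2 : ⟪(injB Ω hΩc).compLpL 2 _ (w - v), q⟫
      = ⟪w - v, (ContinuousLinearMap.adjoint (injB Ω hΩc)).compLpL 2 _ q⟫ := by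
    rw [L2.inner_def, L2.inner_def]
    refine integral_congr_ae ?_
    filter_upwards [(injB Ω hΩc).coeFn_compLpL (p := 2) (μ := volume.restrict (Icc a b)) (w - v),
      (ContinuousLinearMap.adjoint (injB Ω hΩc)).coeFn_compLpL (p := 2)
        (μ := volume.restrict (Icc a b)) q] with s k1 k2
    rw [k1, k2, ContinuousLinearMap.adjoint_inner_right]
  have e3 : ‖y' b - z‖ ^ 2 = ‖y b - z‖ ^ 2 + 2 * ⟪y' b - y b, y b - z⟫ + ‖y' b - y b‖ ^ 2 := by
    rw [← sub_add_sub_cancel (y' b) (y b) z, norm_add_sq_real]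
    ring
  have e4 : ‖w‖ ^ 2 = ‖v‖ ^ 2 + 2 * ⟪w - v, v⟫ + ‖w - v‖ ^ 2 := by
    conv_lhs => rw [← sub_add_cancel w v, norm_add_sq_real]
    ring
  rw [inner_add_right, real_inner_smul_right, ← e2, ← e1, cost, cost, e3, e4]
  ring

/-- The first order optimality condition. -/
theorem IsOptimalControl.smul_add_adjoint_eq_zero [V.HasOrthogonalProjection]
    (hd : ∀ h : L2 Ω, (∀ φ ∈ V, ⟪h, φ.fst⟫ = 0) → h = 0)
    (hν : 0 < ν)
    (hα : 0 < α) (hab : a ≤ b) (hopt : IsOptimalControl hΩc V ν α a b ya z v)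
    (h : IsState hΩc V ν a b ya v y) (hp : IsAdjoint V ν a b (y b - z) p) :
    α • v + (ContinuousLinearMap.adjoint (injB Ω hΩc)).compLpL 2 _
        ((memLp_restrict_Icc_of_continuousOn hp.cont).toLp p) = 0 := by
  obtain ⟨y₀, hy₀, hmin⟩ := hopt
  obtain ⟨C, hC0, hC⟩ := exists_norm_state_sub_le (Ωc := Ωc) (hΩc := hΩc) hd hν hab ya
  have hcost : cost α a b z v y₀ = cost α a b z v y := by
    rw [cost, cost, hy₀.eqOn hν h (right_mem_Icc.2 hab)]
  set g := α • v + (ContinuousLinearMap.adjoint (injB Ω hΩc)).compLpL 2 _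
    ((memLp_restrict_Icc_of_continuousOn hp.cont).toLp p) with hg
  -- One gradient step of length `1 / D`: the quadratic terms cost at most `‖g‖² / (2 D)` while the
  -- linear term gains `‖g‖² / D`, so minimality forces `g = 0`.
  set D := C ^ 2 + α with hD
  have hD0 : 0 < D := by positivity
  obtain ⟨y', hy'⟩ := exists_isState (hΩc := hΩc) hd hν hab ya (v - D⁻¹ • g)
  have e1 := hmin _ _ hy'
  rw [hcost, cost_eq_cost_add hd hν hab h hy' hp, ← hg] at e1
  have e2 := hC _ _ _ _ h hy'
  have e3 : v - D⁻¹ • g - v = (-D⁻¹) • g := by module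
  have e5 : ‖(-D⁻¹) • g‖ = D⁻¹ * ‖g‖ := by
    rw [norm_smul, norm_neg, Real.norm_of_nonneg (inv_nonneg.2 hD0.le)]
  rw [e3, real_inner_smul_left, real_inner_self_eq_norm_sq, e5] at e1
  rw [e3, e5] at e2
  have e6 : ‖y' b - y b‖ ^ 2 ≤ (C * (D⁻¹ * ‖g‖)) ^ 2 := pow_le_pow_left₀ (norm_nonneg _) e2 2
  have e7 : 1 / 2 * (C * (D⁻¹ * ‖g‖)) ^ 2 + α / 2 * (D⁻¹ * ‖g‖) ^ 2 = 1 / 2 * (D⁻¹ * ‖g‖ ^ 2) := by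
    rw [show 1 / 2 * (C * (D⁻¹ * ‖g‖)) ^ 2 + α / 2 * (D⁻¹ * ‖g‖) ^ 2
      = 1 / 2 * (D⁻¹ * ‖g‖ ^ 2) * (D⁻¹ * D) by rw [hD]; ring, inv_mul_cancel₀ hD0.ne', mul_one]
  have e8 : D⁻¹ * ‖g‖ ^ 2 ≤ 0 := by linarith
  have e9 : ‖g‖ ^ 2 ≤ 0 := nonpos_of_mul_nonpos_right e8 (inv_pos.2 hD0)
  simpa using le_antisymm e9 (sq_nonneg _)

theorem IsOptimalitySystem.cost_eq [V.HasOrthogonalProjection]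
    (hd : ∀ h : L2 Ω, (∀ φ ∈ V, ⟪h, φ.fst⟫ = 0) → h = 0)
    (hν : 0 < ν) (hab : a ≤ b)
    (h : IsOptimalitySystem hΩc V ν α a b ya z v y p) {w : Control Ωc a b} {y' : ℝ → L2 Ω}
    (h' : IsState hΩc V ν a b ya w y') :
    cost α a b z w y' = cost α a b z v y + 1 / 2 * ‖y' b - y b‖ ^ 2 + α / 2 * ‖w - v‖ ^ 2 := by
  have h0 : α • v + (ContinuousLinearMap.adjoint (injB Ω hΩc)).compLpL 2 _
      ((memLp_restrict_Icc_of_continuousOn h.adjoint.cont).toLp p) = 0 := by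
    set q := (memLp_restrict_Icc_of_continuousOn h.adjoint.cont).toLp p with hq
    refine Lp.ext ?_
    filter_upwards [h.gradient, Lp.coeFn_zero (L2 Ωc) 2 (volume.restrict (Icc a b)),
      Lp.coeFn_add (α • v) ((ContinuousLinearMap.adjoint (injB Ω hΩc)).compLpL 2 _ q),
      Lp.coeFn_smul α v, (ContinuousLinearMap.adjoint (injB Ω hΩc)).coeFn_compLpL (p := 2)
        (μ := volume.restrict (Icc a b)) q,
      (memLp_restrict_Icc_of_continuousOn h.adjoint.cont).coeFn_toLp] with s k1 k2 k3 k4 k5 k6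
    rw [k2, k3, Pi.add_apply, k4, k5, k6]
    exact k1
  rw [cost_eq_cost_add hd hν hab h.state h' h.adjoint, h0, inner_zero_right, add_zero]

theorem IsOptimalitySystem.isOptimalControl [V.HasOrthogonalProjection]
    (hd : ∀ h : L2 Ω, (∀ φ ∈ V, ⟪h, φ.fst⟫ = 0) → h = 0)
    (hν : 0 < ν) (hα : 0 < α)
    (hab : a ≤ b) (h : IsOptimalitySystem hΩc V ν α a b ya z v y p) :
    IsOptimalControl hΩc V ν α a b ya z v := by
  refine ⟨y, h.state, fun w y' h' => ?_⟩
  rw [h.cost_eq hd hν hab h', add_assoc, le_add_iff_nonneg_right]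
  positivity

theorem IsOptimalitySystem.eq_of_isOptimalControl [V.HasOrthogonalProjection]
    (hd : ∀ h : L2 Ω, (∀ φ ∈ V, ⟪h, φ.fst⟫ = 0) → h = 0)
    (hν : 0 < ν)
    (hα : 0 < α) (hab : a ≤ b) (h : IsOptimalitySystem hΩc V ν α a b ya z v y p)
    {w : Control Ωc a b} (hw : IsOptimalControl hΩc V ν α a b ya z w) : w = v := by
  obtain ⟨y', h', hmin⟩ := hw
  have e1 := hmin v y h.state
  rw [h.cost_eq hd hν hab h'] at e1
  have e2 : α / 2 * ‖w - v‖ ^ 2 ≤ 0 := by nlinarith [sq_nonneg ‖y' b - y b‖]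
  have e3 : ‖w - v‖ ^ 2 ≤ 0 := nonpos_of_mul_nonpos_right e2 (by positivity)
  exact sub_eq_zero.1 (by simpa using le_antisymm e3 (sq_nonneg _))

/-- On a subinterval, the restriction of an optimal control satisfies the optimality system for
the target trajectory. -/
theorem IsOptimalControl.isOptimalitySystem_restrict [V.HasOrthogonalProjection]
    (hd : ∀ h : L2 Ω, (∀ φ ∈ V, ⟪h, φ.fst⟫ = 0) → h = 0)
    (hν : 0 < ν)
    (hα : 0 < α) (hopt : IsOptimalControl hΩc V ν α a b ya z v)
    (h : IsState hΩc V ν a b ya v y) (hp : IsAdjoint V ν a b (y b - z) p) {a' b' : ℝ}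
    (hab : a' ≤ b') (hsub : Icc a' b' ⊆ Icc a b) :
    IsOptimalitySystem hΩc V ν α a' b' (y a') (targetTrajectory y p b') (v.restrict hsub) y p := by
  obtain ⟨ha, hb⟩ := (Icc_subset_Icc_iff hab).1 hsub
  refine ⟨h.restrict hab hsub, ?_, ?_⟩
  -- Here `y(b') - χ(b') = p(b')`: this choice of target makes the restricted `p` the adjoint state.
  · rw [targetTrajectory, sub_sub_cancel]
    exact hp.restrict ha hab hb
  · have h0 := hopt.smul_add_adjoint_eq_zero hd hν hα (ha.trans (hab.trans hb)) h hp
    set q := (memLp_restrict_Icc_of_continuousOn hp.cont).toLp p with hq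
    have hae : ∀ᵐ s ∂(volume.restrict (Icc a b)),
        α • v s + (ContinuousLinearMap.adjoint (injB Ω hΩc)) (p s) = 0 := by
      filter_upwards [Lp.coeFn_zero (L2 Ωc) 2 (volume.restrict (Icc a b)),
        Lp.coeFn_add (α • v) ((ContinuousLinearMap.adjoint (injB Ω hΩc)).compLpL 2 _ q),
        Lp.coeFn_smul α v, (ContinuousLinearMap.adjoint (injB Ω hΩc)).coeFn_compLpL (p := 2)
          (μ := volume.restrict (Icc a b)) q,
        (memLp_restrict_Icc_of_continuousOn hp.cont).coeFn_toLp] with s k2 k3 k4 k5 k6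
      rw [h0, k2, Pi.add_apply, k4, k5, k6] at k3
      exact k3.symm
    filter_upwards [ae_restrict_of_ae_restrict_of_subset hsub hae,
      ((Lp.memLp v).mono_measure (Measure.restrict_mono hsub le_rfl)).coeFn_toLp] with s k1 k2
    rw [← k1]
    exact congrArg (fun u => α • u + _) k2

end Control

end HeatControl

end

theorem lemma2 {d : ℕ} (Ω Ωc : Set (HeatControl.Space d)) (hΩ : IsCompact Ω)
    (hΩ' : volume (frontier Ω) = 0) (hΩc : MeasurableSet Ωc) (hsub : Ωc ⊆ Ω)
    (V : Submodule ℝ (HeatControl.L2Pair Ω)) (hV : HeatControl.IsFormDomain Ω V)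
    (ν α T : ℝ) (hν : 0 < ν) (hα : 0 < α) (hT : 0 < T)
    (y₀ yTarget : HeatControl.L2 Ω)
    (vStar : HeatControl.Control Ωc 0 T) (yStar pStar : ℝ → HeatControl.L2 Ω)
    (hvStar : HeatControl.IsOptimalControl hΩc V ν α 0 T y₀ yTarget vStar)
    (hyStar : HeatControl.IsState hΩc V ν 0 T y₀ vStar yStar)
    (hpStar : HeatControl.IsAdjoint V ν 0 T (yStar T - yTarget) pStar)
    (N : ℕ) (hN : 1 ≤ N) (S : HeatControl.Subdivision T N) (n : Fin N) :
    (∀ w : HeatControl.Control Ωc (S.t n.castSucc) (S.t n.succ),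
      ∃ y, HeatControl.IsState hΩc V ν (S.t n.castSucc) (S.t n.succ)
          (yStar (S.t n.castSucc)) w y ∧
        ∀ y', HeatControl.IsState hΩc V ν (S.t n.castSucc) (S.t n.succ)
          (yStar (S.t n.castSucc)) w y' → EqOn y' y (Icc (S.t n.castSucc) (S.t n.succ))) ∧
    (∀ w : HeatControl.Control Ωc (S.t n.castSucc) (S.t n.succ),
      HeatControl.IsOptimalControl hΩc V ν α (S.t n.castSucc) (S.t n.succ)
          (yStar (S.t n.castSucc))
          (HeatControl.targetTrajectory yStar pStar (S.t n.succ)) w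
        ↔ w = vStar.restrict (S.Icc_subset n)) ∧
    (∀ w : HeatControl.Control Ωc (S.t n.castSucc) (S.t n.succ),
      (∃ y p, HeatControl.IsOptimalitySystem hΩc V ν α (S.t n.castSucc) (S.t n.succ)
          (yStar (S.t n.castSucc))
          (HeatControl.targetTrajectory yStar pStar (S.t n.succ)) w y p)
        ↔ w = vStar.restrict (S.Icc_subset n)) := by
  have : CompleteSpace V := hV.closed.completeSpace_coe
  have hd := hV.eq_zero_of_forall_inner_fst hΩ hΩ'
  have hab : S.t n.castSucc ≤ S.t n.succ := (S.strictMono n.castSucc_lt_succ).le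
  have hsys := hvStar.isOptimalitySystem_restrict hd hν hα hyStar hpStar hab (S.Icc_subset n)
  refine ⟨fun w => ?_, fun w => ⟨fun hw => ?_, ?_⟩, fun w => ⟨?_, ?_⟩⟩
  · obtain ⟨y, hy⟩ := HeatControl.exists_isState (hΩc := hΩc) hd hν hab (yStar (S.t n.castSucc)) w
    exact ⟨y, hy, fun y' hy' => hy'.eqOn hν hy⟩
  · exact hsys.eq_of_isOptimalControl hd hν hα hab hw
  · rintro rfl
    exact hsys.isOptimalControl hd hν hα hab
  · rintro ⟨y, p, h⟩
    -- Any solution of the system is a minimizer, and the minimizer is unique.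
    exact hsys.eq_of_isOptimalControl hd hν hα hab (h.isOptimalControl hd hν hα hab)
  · rintro rfl
    exact ⟨yStar, pStar, hsys⟩
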